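/- Let $q\in\mathbb C$ be non-zero and not a root of unity, and fix $h\in\mathbb C$ with $e^h=q$ (a value of $\ln q$). Let $U_q(\mathfrak{sl}_2)$ be the unital associative $\mathbb C$-algebra generated by $E,F,K,K^{-1}$ with relations $$KK^{-1}=K^{-1}K=1,\quad KE=q^2EK,\quad KF=q^{-2}FK,\quad EF-FE=\frac{K-K^{-1}}{q-q^{-1}},$$ with the Hopf algebra structure $$\Delta(K^{\pm1})=K^{\pm1}\otimes K^{\pm1},\quad \Delta(E)=E\otimes K+1\otimes E,\quad \Delta(F)=F\otimes 1+K^{-1}\otimes F,$$ $$\epsilon(K^{\pm1})=1,\ \epsilon(E)=\epsilon(F)=0,\qquad S(K^{\pm1})=K^{\mp1},\ S(E)=-EK^{-1},\ S(F)=-KF.$$ Adjoin an element $H$ with $[H,E]=2E$, $[H,F]=-2F$, $[H,K]=0$, $\Delta(H)=H\otimes1+1\otimes H$, $\epsilon(H)=0$, $S(H)=-H$, and let $b\triangleright a=\sum b_{(1)}aS(b_{(2)})$ be the left adjoint action of the resulting Hopf algebra $\tilde U$. Identities between elements of $U_q(\mathfrak{sl}_2)\otimes U_q(\mathfrak{sl}_2)$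 and convergence of series are understood in the completion $\prod_{V,W}\operatorname{End}(V\otimes W)$ with the product topology, where $V,W$ run over the finite-dimensional representations of $\tilde U$ on which $q^H:=\exp(hH)$ equals $K$. Let $$R=\sum R_1\otimes R_2=\sum_{n,l\ge0}\Big(\frac{h}{2}\Big)^l\frac1{l!}\,q^{\frac{n(n+1)}2}\frac{(1-q^{-2})^n}{[n]_q!}\,H^lE^n\otimes H^lF^n,$$ where $[n]_q=\frac{q^n-q^{-n}}{q-q^{-1}}$ and $[n]_q!=[n]_q\cdots[1]_q$, $[0]_q!=1$, and define the braided (transmuted) coproduct by $$\underline\Delta(a)=\sum a_{(1)}S(R_2)\otimes (R_1\triangleright a_{(2)}),$$ the sum being taken over the double series of $R$. Then for each $a\in\{E,K,K^{-1},F\}$ this double series is (unconditionally) summable, the infinite series on the right-hand sides below converge (unconditionally), and 1. $\underline\Delta(E)=E\otimes K+K^{-1}\otimes E+q^{-1}(q-q^{-1})^2\,EF\otimes E$; 2. $\underline\Delta(K)=K\otimes K+q^{-1}(q-q^{-1})^2\,KF\otimes E$; 3. $\displaystyle\underline\Delta(K^{-1})=\sum_{n=0}^\infty(-1)^nq^{-n^2-2n}(q-q^{-1})^{2n}\,K^{-1}F^n\otimes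 E^nK^{-n-1}$; 4. $\displaystyle\underline\Delta(F)=1\otimes F+\sum_{n=1}^\infty(-1)^{n+1}q^{-n^2+1}(q-q^{-1})^{2n-2}\,F^n\otimes E^{n-1}K^{-n-1}$. -/

import Mathlib

open scoped TensorProduct

noncomputable section

namespace BraidedSl2

/-! ### Constructions valid in every Hopf algebra -/

section Hopf

variable {A : Type*} [Ring A]

/-- The left (quantum) adjoint action `b ▷ a = ∑ b₍₁₎ a S(b₍₂₎)` of a Hopf algebra on itself,
as the bilinear map `b ↦ (a ↦ b ▷ a)`. -/
def adj [HopfAlgebra ℂ A] : A →ₗ[ℂ] A →ₗ[ℂ] A :=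
  TensorProduct.lift
    (LinearMap.mk₂ ℂ
      (fun b₁ b₂ : A =>
        LinearMap.mulLeft ℂ b₁ ∘ₗ LinearMap.mulRight ℂ (HopfAlgebra.antipode ℂ b₂))
      (fun _ _ _ => by ext; simp [add_mul])
      (fun _ _ _ => by ext; simp)
      (fun _ _ _ => by ext; simp [mul_add])
      (fun _ _ _ => by ext; simp))
    ∘ₗ Coalgebra.comul

/-- For `r = ∑ r₁ ⊗ r₂`, the linear map `x ⊗ y ↦ ∑ x S(r₂) ⊗ (r₁ ▷ y)`, depending linearly
on `r`. -/
def twist [HopfAlgebra ℂ A] : A ⊗[ℂ] A →ₗ[ℂ] (A ⊗[ℂ] A →ₗ[ℂ] A ⊗[ℂ] A) :=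
  TensorProduct.lift
    (LinearMap.mk₂ ℂ
      (fun r₁ r₂ : A =>
        TensorProduct.map (LinearMap.mulRight ℂ (HopfAlgebra.antipode ℂ r₂)) (adj r₁))
      (fun _ _ _ => by ext; simp [TensorProduct.tmul_add])
      (fun _ _ _ => by ext; simp)
      (fun _ _ _ => by ext; simp [mul_add, TensorProduct.add_tmul])
      (fun _ _ _ => by ext; simp [TensorProduct.smul_tmul]))

/-- `∑ a₍₁₎ S(r₂) ⊗ (r₁ ▷ a₍₂₎)` for `r = ∑ r₁ ⊗ r₂`: the contribution of the summand `r` of an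
`R`-matrix to the transmuted coproduct of `a`. -/
def transmuted [HopfAlgebra ℂ A] (r : A ⊗[ℂ] A) (a : A) : A ⊗[ℂ] A :=
  twist r (Coalgebra.comul a)

/-- If `S` is an algebra anti-homomorphism, the identity `∑ S(a₍₁₎) a₍₂₎ = ε(a)` needs to be
checked on algebra generators only. -/
theorem antipode_left [Bialgebra ℂ A] (S : A →ₐ[ℂ] Aᵐᵒᵖ) (s : Set A)
    (hs : Algebra.adjoin ℂ s = ⊤)
    (h : ∀ a ∈ s, LinearMap.mul' ℂ A
      (((MulOpposite.opLinearEquiv ℂ).symm.toLinearMap ∘ₗ S.toLinearMap).rTensor A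
        (Coalgebra.comul a)) = algebraMap ℂ A (Coalgebra.counit a)) (a : A) :
    LinearMap.mul' ℂ A
      (((MulOpposite.opLinearEquiv ℂ).symm.toLinearMap ∘ₗ S.toLinearMap).rTensor A
        (Coalgebra.comul a)) = algebraMap ℂ A (Coalgebra.counit a) := by
  have ha : a ∈ Algebra.adjoin ℂ s := hs ▸ Algebra.mem_top
  induction ha using Algebra.adjoin_induction with
  | mem x hx => exact h x hx
  | algebraMap r =>
    simp [Algebra.TensorProduct.one_def, Algebra.algebraMap_eq_smul_one]
  | add x y _ _ hx hy => simp only [map_add, hx, hy]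
  | mul x y _ _ hx hy =>
    have key : ∀ (u v : A ⊗[ℂ] A) (c : ℂ),
        LinearMap.mul' ℂ A (((MulOpposite.opLinearEquiv ℂ).symm.toLinearMap ∘ₗ
          S.toLinearMap).rTensor A u) = algebraMap ℂ A c →
        LinearMap.mul' ℂ A (((MulOpposite.opLinearEquiv ℂ).symm.toLinearMap ∘ₗ
          S.toLinearMap).rTensor A (u * v)) =
        c • LinearMap.mul' ℂ A (((MulOpposite.opLinearEquiv ℂ).symm.toLinearMap ∘ₗ
          S.toLinearMap).rTensor A v) := by
      intro u v c hu
      induction v with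
      | zero => simp
      | add v w hv hw => rw [mul_add, map_add, map_add, hv, hw, map_add, map_add, smul_add]
      | tmul p r =>
        have : ∀ u : A ⊗[ℂ] A, LinearMap.mul' ℂ A (((MulOpposite.opLinearEquiv ℂ).symm.toLinearMap
            ∘ₗ S.toLinearMap).rTensor A (u * (p ⊗ₜ r))) =
            (S p).unop * LinearMap.mul' ℂ A (((MulOpposite.opLinearEquiv ℂ).symm.toLinearMap ∘ₗ
          S.toLinearMap).rTensor A u) * r := by
          intro u
          induction u with
          | zero => simp
          | add v w hv hw => rw [add_mul, map_add, map_add, hv, hw, map_add, map_add, mul_add,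
              add_mul]
          | tmul m n => simp [mul_assoc]
        rw [this, hu, ← Algebra.commutes, mul_assoc, ← Algebra.smul_def]
        simp
    rw [Bialgebra.comul_mul, key _ _ _ hx, hy, Bialgebra.counit_mul, map_mul, Algebra.smul_def]

/-- If `S` is an algebra anti-homomorphism, the identity `∑ a₍₁₎ S(a₍₂₎) = ε(a)` needs to be
checked on algebra generators only. -/
theorem antipode_right [Bialgebra ℂ A] (S : A →ₐ[ℂ] Aᵐᵒᵖ) (s : Set A)
    (hs : Algebra.adjoin ℂ s = ⊤)
    (h : ∀ a ∈ s, LinearMap.mul' ℂ A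
      (((MulOpposite.opLinearEquiv ℂ).symm.toLinearMap ∘ₗ S.toLinearMap).lTensor A
        (Coalgebra.comul a)) = algebraMap ℂ A (Coalgebra.counit a)) (a : A) :
    LinearMap.mul' ℂ A
      (((MulOpposite.opLinearEquiv ℂ).symm.toLinearMap ∘ₗ S.toLinearMap).lTensor A
        (Coalgebra.comul a)) = algebraMap ℂ A (Coalgebra.counit a) := by
  have ha : a ∈ Algebra.adjoin ℂ s := hs ▸ Algebra.mem_top
  induction ha using Algebra.adjoin_induction with
  | mem x hx => exact h x hx
  | algebraMap r =>
    simp [Algebra.TensorProduct.one_def, Algebra.algebraMap_eq_smul_one]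
  | add x y _ _ hx hy => simp only [map_add, hx, hy]
  | mul x y _ _ hx hy =>
    have key : ∀ (u v : A ⊗[ℂ] A) (c : ℂ),
        LinearMap.mul' ℂ A (((MulOpposite.opLinearEquiv ℂ).symm.toLinearMap ∘ₗ
          S.toLinearMap).lTensor A v) = algebraMap ℂ A c →
        LinearMap.mul' ℂ A (((MulOpposite.opLinearEquiv ℂ).symm.toLinearMap ∘ₗ
          S.toLinearMap).lTensor A (u * v)) =
        c • LinearMap.mul' ℂ A (((MulOpposite.opLinearEquiv ℂ).symm.toLinearMap ∘ₗ
          S.toLinearMap).lTensor A u) := by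
      intro u v c hv
      induction u with
      | zero => simp
      | add v w hv hw => rw [add_mul, map_add, map_add, hv, hw, map_add, map_add, smul_add]
      | tmul p r =>
        have : ∀ u : A ⊗[ℂ] A, LinearMap.mul' ℂ A (((MulOpposite.opLinearEquiv ℂ).symm.toLinearMap
            ∘ₗ S.toLinearMap).lTensor A ((p ⊗ₜ r) * u)) =
            p * LinearMap.mul' ℂ A (((MulOpposite.opLinearEquiv ℂ).symm.toLinearMap ∘ₗ
          S.toLinearMap).lTensor A u) * (S r).unop := by
          intro u
          induction u with
          | zero => simp
          | add v w hv hw => rw [mul_add, map_add, map_add, hv, hw, map_add, map_add, mul_add,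
              add_mul]
          | tmul m n => simp [mul_assoc]
        rw [this, hv, ← Algebra.commutes, mul_assoc, ← Algebra.smul_def]
        simp
    rw [Bialgebra.comul_mul, key _ _ _ hy, hx, Bialgebra.counit_mul, map_mul, Algebra.smul_def,
      Algebra.commutes]

end Hopf

/-! ### The Hopf algebra `U_q(sl₂)` -/

/-- The generators of `U_q(sl₂)`. -/
inductive Gen
  | E | F | K | Kinv

/-- The defining relations of `U_q(sl₂)`. -/
inductive Rel (q : ℂ) : FreeAlgebra ℂ Gen → FreeAlgebra ℂ Gen → Prop
  | K_Kinv : Rel q (FreeAlgebra.ι ℂ .K * FreeAlgebra.ι ℂ .Kinv) 1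
  | Kinv_K : Rel q (FreeAlgebra.ι ℂ .Kinv * FreeAlgebra.ι ℂ .K) 1
  | K_E : Rel q (FreeAlgebra.ι ℂ .K * FreeAlgebra.ι ℂ .E)
      (q ^ 2 • (FreeAlgebra.ι ℂ .E * FreeAlgebra.ι ℂ .K))
  | K_F : Rel q (FreeAlgebra.ι ℂ .K * FreeAlgebra.ι ℂ .F)
      (q ^ (-2 : ℤ) • (FreeAlgebra.ι ℂ .F * FreeAlgebra.ι ℂ .K))
  | E_F : Rel q
      (FreeAlgebra.ι ℂ .E * FreeAlgebra.ι ℂ .F - FreeAlgebra.ι ℂ .F * FreeAlgebra.ι ℂ .E)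
      ((q - q⁻¹)⁻¹ • (FreeAlgebra.ι ℂ .K - FreeAlgebra.ι ℂ .Kinv))

/-- The algebra `U_q(sl₂)`, by generators and relations. -/
def Uq (q : ℂ) : Type := RingQuot (Rel q)

namespace Uq

variable (q : ℂ)

instance : Ring (Uq q) := inferInstanceAs (Ring (RingQuot (Rel q)))
instance : Algebra ℂ (Uq q) := inferInstanceAs (Algebra ℂ (RingQuot (Rel q)))

/-- The quotient map from the free algebra. -/
def mk : FreeAlgebra ℂ Gen →ₐ[ℂ] Uq q := RingQuot.mkAlgHom ℂ (Rel q)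

/-- The generator `E`. -/
def E : Uq q := mk q (FreeAlgebra.ι ℂ .E)
/-- The generator `F`. -/
def F : Uq q := mk q (FreeAlgebra.ι ℂ .F)
/-- The generator `K`. -/
def K : Uq q := mk q (FreeAlgebra.ι ℂ .K)
/-- The generator `K⁻¹`. -/
def Kinv : Uq q := mk q (FreeAlgebra.ι ℂ .Kinv)

theorem mk_rel {x y : FreeAlgebra ℂ Gen} (h : Rel q x y) : mk q x = mk q y :=
  RingQuot.mkAlgHom_rel ℂ h

theorem K_Kinv : K q * Kinv q = 1 := by
  simpa only [map_mul, map_sub, map_smul, map_one, E, F, K, Kinv] using mk_rel q Rel.K_Kinv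
theorem Kinv_K : Kinv q * K q = 1 := by
  simpa only [map_mul, map_sub, map_smul, map_one, E, F, K, Kinv] using mk_rel q Rel.Kinv_K
theorem K_E : K q * E q = q ^ 2 • (E q * K q) := by
  simpa only [map_mul, map_sub, map_smul, map_one, E, F, K, Kinv] using mk_rel q Rel.K_E
theorem K_F : K q * F q = q ^ (-2 : ℤ) • (F q * K q) := by
  simpa only [map_mul, map_sub, map_smul, map_one, E, F, K, Kinv] using mk_rel q Rel.K_F
theorem E_F : E q * F q - F q * E q = (q - q⁻¹)⁻¹ • (K q - Kinv q) := by
  simpa only [map_mul, map_sub, map_smul, map_one, E, F, K, Kinv] using mk_rel q Rel.E_F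
theorem E_Kinv : E q * Kinv q = q ^ 2 • (Kinv q * E q) := by
  calc E q * Kinv q = Kinv q * (K q * E q) * Kinv q := by rw [← mul_assoc, Kinv_K, one_mul]
    _ = _ := by rw [K_E, mul_smul_comm, smul_mul_assoc, mul_assoc, mul_assoc, K_Kinv, mul_one]
theorem F_Kinv : F q * Kinv q = q ^ (-2 : ℤ) • (Kinv q * F q) := by
  calc F q * Kinv q = Kinv q * (K q * F q) * Kinv q := by rw [← mul_assoc, Kinv_K, one_mul]
    _ = _ := by rw [K_F, mul_smul_comm, smul_mul_assoc, mul_assoc, mul_assoc, K_Kinv, mul_one]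
theorem E_zero (hq : q = 0) : E q = 0 := by
  calc E q = Kinv q * (K q * E q) := by rw [← mul_assoc, Kinv_K, one_mul]
    _ = 0 := by rw [K_E, hq]; simp

variable {q} in
/-- The universal property: images of the generators satisfying the relations. -/
def lift {B : Type*} [Ring B] [Algebra ℂ B] (e f k k' : B)
    (h1 : k * k' = 1) (h2 : k' * k = 1) (h3 : k * e = q ^ 2 • (e * k))
    (h4 : k * f = q ^ (-2 : ℤ) • (f * k)) (h5 : e * f - f * e = (q - q⁻¹)⁻¹ • (k - k')) :
    Uq q →ₐ[ℂ] B :=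
  RingQuot.liftAlgHom ℂ ⟨FreeAlgebra.lift ℂ fun
    | .E => e | .F => f | .K => k | .Kinv => k',
    by rintro _ _ (_ | _ | _ | _ | _) <;>
      simpa only [map_mul, map_sub, map_smul, map_one, FreeAlgebra.lift_ι_apply]⟩

section
variable {q} {B : Type*} [Ring B] [Algebra ℂ B] {e f k k' : B}
    {h1 : k * k' = 1} {h2 : k' * k = 1} {h3 : k * e = q ^ 2 • (e * k)}
    {h4 : k * f = q ^ (-2 : ℤ) • (f * k)} {h5 : e * f - f * e = (q - q⁻¹)⁻¹ • (k - k')}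

@[simp] theorem lift_E : lift e f k k' h1 h2 h3 h4 h5 (E q) = e :=
  (RingQuot.liftAlgHom_mkAlgHom_apply ..).trans (FreeAlgebra.lift_ι_apply ..)
@[simp] theorem lift_F : lift e f k k' h1 h2 h3 h4 h5 (F q) = f :=
  (RingQuot.liftAlgHom_mkAlgHom_apply ..).trans (FreeAlgebra.lift_ι_apply ..)
@[simp] theorem lift_K : lift e f k k' h1 h2 h3 h4 h5 (K q) = k :=
  (RingQuot.liftAlgHom_mkAlgHom_apply ..).trans (FreeAlgebra.lift_ι_apply ..)
@[simp] theorem lift_Kinv : lift e f k k' h1 h2 h3 h4 h5 (Kinv q) = k' :=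
  (RingQuot.liftAlgHom_mkAlgHom_apply ..).trans (FreeAlgebra.lift_ι_apply ..)

end

variable {q} in
theorem algHom_ext {B : Type*} [Ring B] [Algebra ℂ B] {φ ψ : Uq q →ₐ[ℂ] B}
    (hE : φ (E q) = ψ (E q)) (hF : φ (F q) = ψ (F q))
    (hK : φ (K q) = ψ (K q)) (hKinv : φ (Kinv q) = ψ (Kinv q)) : φ = ψ := by
  refine RingQuot.ringQuot_ext' ℂ φ ψ (FreeAlgebra.hom_ext (funext fun x => ?_))
  cases x <;> assumption

theorem adjoin_eq_top : Algebra.adjoin ℂ {E q, F q, K q, Kinv q} = (⊤ : Subalgebra ℂ (Uq q)) := by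
  set S := Algebra.adjoin ℂ {E q, F q, K q, Kinv q} with hS
  have hm : ∀ x ∈ ({E q, F q, K q, Kinv q} : Set (Uq q)), x ∈ S := fun x hx =>
    Algebra.subset_adjoin hx
  have hc : ((S.val.comp (FreeAlgebra.lift ℂ (fun x : Gen => (match x with
    | .E => ⟨E q, hm _ (by simp)⟩
    | .F => ⟨F q, hm _ (by simp)⟩
    | .K => ⟨K q, hm _ (by simp)⟩
    | .Kinv => ⟨Kinv q, hm _ (by simp)⟩ : S)))) :
      FreeAlgebra ℂ Gen →ₐ[ℂ] Uq q) = mk q := by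
    refine FreeAlgebra.hom_ext (funext fun x => ?_)
    cases x <;> simp [E, F, K, Kinv]
  refine eq_top_iff.2 fun x _ => ?_
  obtain ⟨y, rfl⟩ := RingQuot.mkAlgHom_surjective ℂ (Rel q) x
  change mk q y ∈ S
  rw [← hc]
  exact Subtype.property _

theorem comul_E_F :
    (E q ⊗ₜ[ℂ] K q + 1 ⊗ₜ[ℂ] E q) * (F q ⊗ₜ[ℂ] 1 + Kinv q ⊗ₜ[ℂ] F q)
      - (F q ⊗ₜ[ℂ] 1 + Kinv q ⊗ₜ[ℂ] F q) * (E q ⊗ₜ[ℂ] K q + 1 ⊗ₜ[ℂ] E q)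
      = (q - q⁻¹)⁻¹ • (K q ⊗ₜ[ℂ] K q - Kinv q ⊗ₜ[ℂ] Kinv q) := by
  have hx : (E q * Kinv q) ⊗ₜ[ℂ] (K q * F q) = (Kinv q * E q) ⊗ₜ[ℂ] (F q * K q) := by
    by_cases hq : q = 0
    · simp [E_zero q hq]
    · rw [E_Kinv, K_F, TensorProduct.smul_tmul_smul]
      simp [hq]
  have h1 : (E q * F q) ⊗ₜ[ℂ] K q - (F q * E q) ⊗ₜ[ℂ] K q
      = (q - q⁻¹)⁻¹ • (K q ⊗ₜ[ℂ] K q - Kinv q ⊗ₜ[ℂ] K q) := by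
    rw [← TensorProduct.sub_tmul, E_F, ← TensorProduct.smul_tmul', TensorProduct.sub_tmul]
  have h2 : Kinv q ⊗ₜ[ℂ] (E q * F q) - Kinv q ⊗ₜ[ℂ] (F q * E q)
      = (q - q⁻¹)⁻¹ • (Kinv q ⊗ₜ[ℂ] K q - Kinv q ⊗ₜ[ℂ] Kinv q) := by
    rw [← TensorProduct.tmul_sub, E_F, TensorProduct.tmul_smul, TensorProduct.tmul_sub]
  have h3 := congrArg₂ (· + ·) h1 h2
  simp only [← smul_add, sub_add_sub_cancel] at h3
  rw [← h3]
  simp only [mul_add, add_mul, Algebra.TensorProduct.tmul_mul_tmul, mul_one, one_mul, hx]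
  abel

/-- The coproduct. -/
def comulHom : Uq q →ₐ[ℂ] Uq q ⊗[ℂ] Uq q :=
  lift (E q ⊗ₜ K q + 1 ⊗ₜ E q) (F q ⊗ₜ 1 + Kinv q ⊗ₜ F q) (K q ⊗ₜ K q) (Kinv q ⊗ₜ Kinv q)
    (by simp [K_Kinv, Algebra.TensorProduct.one_def])
    (by simp [Kinv_K, Algebra.TensorProduct.one_def])
    (by simp only [mul_add, add_mul, Algebra.TensorProduct.tmul_mul_tmul, K_E, mul_one, one_mul,
          TensorProduct.tmul_smul, ← TensorProduct.smul_tmul', smul_add])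
    (by simp only [mul_add, add_mul, Algebra.TensorProduct.tmul_mul_tmul, K_F, mul_one, one_mul,
          TensorProduct.tmul_smul, ← TensorProduct.smul_tmul', smul_add, K_Kinv, Kinv_K])
    (comul_E_F q)

/-- The counit. -/
def counitHom : Uq q →ₐ[ℂ] ℂ :=
  lift 0 0 1 1 (by simp) (by simp) (by simp) (by simp) (by simp)

/-- The antipode, as an algebra homomorphism to the opposite algebra. -/
def antipodeHom : Uq q →ₐ[ℂ] (Uq q)ᵐᵒᵖ :=
  lift (.op (-(E q * Kinv q))) (.op (-(K q * F q))) (.op (Kinv q)) (.op (K q))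
    (by rw [← MulOpposite.op_mul, K_Kinv, MulOpposite.op_one])
    (by rw [← MulOpposite.op_mul, Kinv_K, MulOpposite.op_one])
    (by
      rw [← MulOpposite.op_mul, ← MulOpposite.op_mul, ← MulOpposite.op_smul]
      congr 1
      rw [neg_mul, mul_neg, smul_neg, ← mul_assoc, E_Kinv, smul_mul_assoc])
    (by
      rw [← MulOpposite.op_mul, ← MulOpposite.op_mul, ← MulOpposite.op_smul]
      congr 1
      rw [neg_mul, mul_neg, smul_neg, ← mul_assoc, Kinv_K, K_F, smul_mul_assoc, mul_assoc, K_Kinv,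
        one_mul, mul_one])
    (by
      rw [← MulOpposite.op_mul, ← MulOpposite.op_mul, ← MulOpposite.op_sub, ← MulOpposite.op_sub,
        ← MulOpposite.op_smul]
      congr 1
      have h1 : -(K q * F q) * -(E q * Kinv q) = F q * E q := by
        rw [neg_mul_neg]
        by_cases hq : q = 0
        · simp [E_zero q hq]
        · rw [K_F, E_Kinv, smul_mul_smul_comm, mul_assoc, ← mul_assoc (K q), K_Kinv, one_mul]
          simp [hq]
      have h2 : -(E q * Kinv q) * -(K q * F q) = E q * F q := by
        rw [neg_mul_neg, mul_assoc, ← mul_assoc (Kinv q), Kinv_K, one_mul]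
      rw [h1, h2, ← neg_sub, E_F, ← smul_neg, neg_sub])

instance : Bialgebra ℂ (Uq q) :=
  Bialgebra.ofAlgHom (comulHom q) (counitHom q)
    (by
      apply algHom_ext <;>
        simp [comulHom, TensorProduct.tmul_add, TensorProduct.add_tmul, add_assoc,
          Algebra.TensorProduct.one_def])
    (by apply algHom_ext <;> simp [comulHom, counitHom])
    (by apply algHom_ext <;> simp [comulHom, counitHom])

theorem comul_eq (a : Uq q) : Coalgebra.comul (R := ℂ) a = comulHom q a := rfl
theorem counit_eq (a : Uq q) : Coalgebra.counit (R := ℂ) a = counitHom q a := rfl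

instance : HopfAlgebra ℂ (Uq q) where
  antipode := (MulOpposite.opLinearEquiv ℂ).symm.toLinearMap ∘ₗ (antipodeHom q).toLinearMap
  mul_antipode_rTensor_comul := LinearMap.ext <| antipode_left (antipodeHom q) _ (adjoin_eq_top q) <| by
    rintro a (rfl | rfl | rfl | rfl) <;>
      simp [comul_eq, counit_eq, comulHom, counitHom, antipodeHom, K_Kinv, Kinv_K, mul_assoc]
  mul_antipode_lTensor_comul := LinearMap.ext <| antipode_right (antipodeHom q) _ (adjoin_eq_top q) <| by
    rintro a (rfl | rfl | rfl | rfl) <;>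
      simp [comul_eq, counit_eq, comulHom, counitHom, antipodeHom, K_Kinv, Kinv_K, ← mul_assoc]

end Uq

/-! ### The Hopf algebra `U_q(sl₂)` with `H` adjoined -/

/-- The generators of `U_q(sl₂)` with `H` adjoined. -/
inductive GenH
  | E | F | K | Kinv | H

/-- The defining relations of `U_q(sl₂)` with `H` adjoined: those of `U_q(sl₂)`, and the usual commutation relations
of the Cartan element `H` with `E` and `F` (and with `K`). -/
inductive RelH (q : ℂ) : FreeAlgebra ℂ GenH → FreeAlgebra ℂ GenH → Prop
  | K_Kinv : RelH q (FreeAlgebra.ι ℂ .K * FreeAlgebra.ι ℂ .Kinv) 1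
  | Kinv_K : RelH q (FreeAlgebra.ι ℂ .Kinv * FreeAlgebra.ι ℂ .K) 1
  | K_E : RelH q (FreeAlgebra.ι ℂ .K * FreeAlgebra.ι ℂ .E)
      (q ^ 2 • (FreeAlgebra.ι ℂ .E * FreeAlgebra.ι ℂ .K))
  | K_F : RelH q (FreeAlgebra.ι ℂ .K * FreeAlgebra.ι ℂ .F)
      (q ^ (-2 : ℤ) • (FreeAlgebra.ι ℂ .F * FreeAlgebra.ι ℂ .K))
  | E_F : RelH q
      (FreeAlgebra.ι ℂ .E * FreeAlgebra.ι ℂ .F - FreeAlgebra.ι ℂ .F * FreeAlgebra.ι ℂ .E)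
      ((q - q⁻¹)⁻¹ • (FreeAlgebra.ι ℂ .K - FreeAlgebra.ι ℂ .Kinv))
  | H_E : RelH q (FreeAlgebra.ι ℂ .H * FreeAlgebra.ι ℂ .E - FreeAlgebra.ι ℂ .E * FreeAlgebra.ι ℂ .H) ((2 : ℂ) • FreeAlgebra.ι ℂ .E)
  | H_F : RelH q (FreeAlgebra.ι ℂ .H * FreeAlgebra.ι ℂ .F - FreeAlgebra.ι ℂ .F * FreeAlgebra.ι ℂ .H) ((-2 : ℂ) • FreeAlgebra.ι ℂ .F)
  | H_K : RelH q (FreeAlgebra.ι ℂ .H * FreeAlgebra.ι ℂ .K) (FreeAlgebra.ι ℂ .K * FreeAlgebra.ι ℂ .H)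

/-- The algebra `U_q(sl₂)` with an element `H` adjoined, by generators and relations. The further
relation `q ^ H = K` involves a power series in `H`; it is imposed in the completion below. -/
def UqH (q : ℂ) : Type := RingQuot (RelH q)

namespace UqH

variable (q : ℂ)

instance : Ring (UqH q) := inferInstanceAs (Ring (RingQuot (RelH q)))
instance : Algebra ℂ (UqH q) := inferInstanceAs (Algebra ℂ (RingQuot (RelH q)))

/-- The quotient map from the free algebra. -/
def mk : FreeAlgebra ℂ GenH →ₐ[ℂ] UqH q := RingQuot.mkAlgHom ℂ (RelH q)

/-- The generator `E`. -/
def E : UqH q := mk q (FreeAlgebra.ι ℂ .E)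
/-- The generator `F`. -/
def F : UqH q := mk q (FreeAlgebra.ι ℂ .F)
/-- The generator `K`. -/
def K : UqH q := mk q (FreeAlgebra.ι ℂ .K)
/-- The generator `K⁻¹`. -/
def Kinv : UqH q := mk q (FreeAlgebra.ι ℂ .Kinv)
/-- The generator `H`. -/
def H : UqH q := mk q (FreeAlgebra.ι ℂ .H)

theorem mk_rel {x y : FreeAlgebra ℂ GenH} (h : RelH q x y) : mk q x = mk q y :=
  RingQuot.mkAlgHom_rel ℂ h

theorem K_Kinv : K q * Kinv q = 1 := by
  simpa only [map_mul, map_sub, map_smul, map_one, E, F, K, Kinv, H] using mk_rel q RelH.K_Kinv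
theorem Kinv_K : Kinv q * K q = 1 := by
  simpa only [map_mul, map_sub, map_smul, map_one, E, F, K, Kinv, H] using mk_rel q RelH.Kinv_K
theorem K_E : K q * E q = q ^ 2 • (E q * K q) := by
  simpa only [map_mul, map_sub, map_smul, map_one, E, F, K, Kinv, H] using mk_rel q RelH.K_E
theorem K_F : K q * F q = q ^ (-2 : ℤ) • (F q * K q) := by
  simpa only [map_mul, map_sub, map_smul, map_one, E, F, K, Kinv, H] using mk_rel q RelH.K_F
theorem E_F : E q * F q - F q * E q = (q - q⁻¹)⁻¹ • (K q - Kinv q) := by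
  simpa only [map_mul, map_sub, map_smul, map_one, E, F, K, Kinv, H] using mk_rel q RelH.E_F
theorem H_E : H q * E q - E q * H q = (2 : ℂ) • E q := by
  simpa only [map_mul, map_sub, map_smul, map_one, E, F, K, Kinv, H] using mk_rel q RelH.H_E
theorem H_F : H q * F q - F q * H q = (-2 : ℂ) • F q := by
  simpa only [map_mul, map_sub, map_smul, map_one, E, F, K, Kinv, H] using mk_rel q RelH.H_F
theorem H_K : H q * K q = K q * H q := by
  simpa only [map_mul, map_sub, map_smul, map_one, E, F, K, Kinv, H] using mk_rel q RelH.H_K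
theorem H_Kinv : H q * Kinv q = Kinv q * H q := by
  calc H q * Kinv q = Kinv q * (K q * H q) * Kinv q := by rw [← mul_assoc, Kinv_K, one_mul]
    _ = Kinv q * H q := by rw [← H_K, mul_assoc, mul_assoc, K_Kinv, mul_one]
theorem E_Kinv : E q * Kinv q = q ^ 2 • (Kinv q * E q) := by
  calc E q * Kinv q = Kinv q * (K q * E q) * Kinv q := by rw [← mul_assoc, Kinv_K, one_mul]
    _ = _ := by rw [K_E, mul_smul_comm, smul_mul_assoc, mul_assoc, mul_assoc, K_Kinv, mul_one]
theorem F_Kinv : F q * Kinv q = q ^ (-2 : ℤ) • (Kinv q * F q) := by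
  calc F q * Kinv q = Kinv q * (K q * F q) * Kinv q := by rw [← mul_assoc, Kinv_K, one_mul]
    _ = _ := by rw [K_F, mul_smul_comm, smul_mul_assoc, mul_assoc, mul_assoc, K_Kinv, mul_one]
theorem E_zero (hq : q = 0) : E q = 0 := by
  calc E q = Kinv q * (K q * E q) := by rw [← mul_assoc, Kinv_K, one_mul]
    _ = 0 := by rw [K_E, hq]; simp

variable {q} in
/-- The universal property: images of the generators satisfying the relations. -/
def lift {B : Type*} [Ring B] [Algebra ℂ B] (e f k k' h : B)
    (h1 : k * k' = 1) (h2 : k' * k = 1) (h3 : k * e = q ^ 2 • (e * k))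
    (h4 : k * f = q ^ (-2 : ℤ) • (f * k)) (h5 : e * f - f * e = (q - q⁻¹)⁻¹ • (k - k'))
    (h6 : h * e - e * h = (2 : ℂ) • e) (h7 : h * f - f * h = (-2 : ℂ) • f) (h8 : h * k = k * h) :
    UqH q →ₐ[ℂ] B :=
  RingQuot.liftAlgHom ℂ ⟨FreeAlgebra.lift ℂ fun
    | .E => e | .F => f | .K => k | .Kinv => k' | .H => h,
    by rintro _ _ (_ | _ | _ | _ | _ | _ | _ | _) <;>
      simpa only [map_mul, map_sub, map_smul, map_one, FreeAlgebra.lift_ι_apply]⟩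

section
variable {q} {B : Type*} [Ring B] [Algebra ℂ B] {e f k k' h : B}
    {h1 : k * k' = 1} {h2 : k' * k = 1} {h3 : k * e = q ^ 2 • (e * k)}
    {h4 : k * f = q ^ (-2 : ℤ) • (f * k)} {h5 : e * f - f * e = (q - q⁻¹)⁻¹ • (k - k')}
    {h6 : h * e - e * h = (2 : ℂ) • e} {h7 : h * f - f * h = (-2 : ℂ) • f} {h8 : h * k = k * h}

@[simp] theorem lift_E : lift e f k k' h h1 h2 h3 h4 h5 h6 h7 h8 (E q) = e :=
  (RingQuot.liftAlgHom_mkAlgHom_apply ..).trans (FreeAlgebra.lift_ι_apply ..)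
@[simp] theorem lift_F : lift e f k k' h h1 h2 h3 h4 h5 h6 h7 h8 (F q) = f :=
  (RingQuot.liftAlgHom_mkAlgHom_apply ..).trans (FreeAlgebra.lift_ι_apply ..)
@[simp] theorem lift_K : lift e f k k' h h1 h2 h3 h4 h5 h6 h7 h8 (K q) = k :=
  (RingQuot.liftAlgHom_mkAlgHom_apply ..).trans (FreeAlgebra.lift_ι_apply ..)
@[simp] theorem lift_Kinv : lift e f k k' h h1 h2 h3 h4 h5 h6 h7 h8 (Kinv q) = k' :=
  (RingQuot.liftAlgHom_mkAlgHom_apply ..).trans (FreeAlgebra.lift_ι_apply ..)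
@[simp] theorem lift_H : lift e f k k' h h1 h2 h3 h4 h5 h6 h7 h8 (H q) = h :=
  (RingQuot.liftAlgHom_mkAlgHom_apply ..).trans (FreeAlgebra.lift_ι_apply ..)

end

variable {q} in
theorem algHom_ext {B : Type*} [Ring B] [Algebra ℂ B] {φ ψ : UqH q →ₐ[ℂ] B}
    (hE : φ (E q) = ψ (E q)) (hF : φ (F q) = ψ (F q))
    (hK : φ (K q) = ψ (K q)) (hKinv : φ (Kinv q) = ψ (Kinv q)) (hH : φ (H q) = ψ (H q)) : φ = ψ := by
  refine RingQuot.ringQuot_ext' ℂ φ ψ (FreeAlgebra.hom_ext (funext fun x => ?_))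
  cases x <;> assumption

theorem adjoin_eq_top : Algebra.adjoin ℂ {E q, F q, K q, Kinv q, H q} = (⊤ : Subalgebra ℂ (UqH q)) := by
  set S := Algebra.adjoin ℂ {E q, F q, K q, Kinv q, H q} with hS
  have hm : ∀ x ∈ ({E q, F q, K q, Kinv q, H q} : Set (UqH q)), x ∈ S := fun x hx =>
    Algebra.subset_adjoin hx
  have hc : ((S.val.comp (FreeAlgebra.lift ℂ (fun x : GenH => (match x with
    | .E => ⟨E q, hm _ (by simp)⟩
    | .F => ⟨F q, hm _ (by simp)⟩
    | .K => ⟨K q, hm _ (by simp)⟩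
    | .Kinv => ⟨Kinv q, hm _ (by simp)⟩
    | .H => ⟨H q, hm _ (by simp)⟩ : S)))) :
      FreeAlgebra ℂ GenH →ₐ[ℂ] UqH q) = mk q := by
    refine FreeAlgebra.hom_ext (funext fun x => ?_)
    cases x <;> simp [E, F, K, Kinv, H]
  refine eq_top_iff.2 fun x _ => ?_
  obtain ⟨y, rfl⟩ := RingQuot.mkAlgHom_surjective ℂ (RelH q) x
  change mk q y ∈ S
  rw [← hc]
  exact Subtype.property _

theorem comul_E_F :
    (E q ⊗ₜ[ℂ] K q + 1 ⊗ₜ[ℂ] E q) * (F q ⊗ₜ[ℂ] 1 + Kinv q ⊗ₜ[ℂ] F q)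
      - (F q ⊗ₜ[ℂ] 1 + Kinv q ⊗ₜ[ℂ] F q) * (E q ⊗ₜ[ℂ] K q + 1 ⊗ₜ[ℂ] E q)
      = (q - q⁻¹)⁻¹ • (K q ⊗ₜ[ℂ] K q - Kinv q ⊗ₜ[ℂ] Kinv q) := by
  have hx : (E q * Kinv q) ⊗ₜ[ℂ] (K q * F q) = (Kinv q * E q) ⊗ₜ[ℂ] (F q * K q) := by
    by_cases hq : q = 0
    · simp [E_zero q hq]
    · rw [E_Kinv, K_F, TensorProduct.smul_tmul_smul]
      simp [hq]
  have h1 : (E q * F q) ⊗ₜ[ℂ] K q - (F q * E q) ⊗ₜ[ℂ] K q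
      = (q - q⁻¹)⁻¹ • (K q ⊗ₜ[ℂ] K q - Kinv q ⊗ₜ[ℂ] K q) := by
    rw [← TensorProduct.sub_tmul, E_F, ← TensorProduct.smul_tmul', TensorProduct.sub_tmul]
  have h2 : Kinv q ⊗ₜ[ℂ] (E q * F q) - Kinv q ⊗ₜ[ℂ] (F q * E q)
      = (q - q⁻¹)⁻¹ • (Kinv q ⊗ₜ[ℂ] K q - Kinv q ⊗ₜ[ℂ] Kinv q) := by
    rw [← TensorProduct.tmul_sub, E_F, TensorProduct.tmul_smul, TensorProduct.tmul_sub]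
  have h3 := congrArg₂ (· + ·) h1 h2
  simp only [← smul_add, sub_add_sub_cancel] at h3
  rw [← h3]
  simp only [mul_add, add_mul, Algebra.TensorProduct.tmul_mul_tmul, mul_one, one_mul, hx]
  abel

/-- The coproduct. -/
def comulHom : UqH q →ₐ[ℂ] UqH q ⊗[ℂ] UqH q :=
  lift (E q ⊗ₜ K q + 1 ⊗ₜ E q) (F q ⊗ₜ 1 + Kinv q ⊗ₜ F q) (K q ⊗ₜ K q) (Kinv q ⊗ₜ Kinv q) (H q ⊗ₜ 1 + 1 ⊗ₜ H q)
    (by simp [K_Kinv, Algebra.TensorProduct.one_def])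
    (by simp [Kinv_K, Algebra.TensorProduct.one_def])
    (by simp only [mul_add, add_mul, Algebra.TensorProduct.tmul_mul_tmul, K_E, mul_one, one_mul,
          TensorProduct.tmul_smul, ← TensorProduct.smul_tmul', smul_add])
    (by simp only [mul_add, add_mul, Algebra.TensorProduct.tmul_mul_tmul, K_F, mul_one, one_mul,
          TensorProduct.tmul_smul, ← TensorProduct.smul_tmul', smul_add, K_Kinv, Kinv_K])
    (comul_E_F q)
    (by
      have h1 : (H q * E q) ⊗ₜ[ℂ] K q = (E q * H q) ⊗ₜ[ℂ] K q + (2 : ℂ) • (E q ⊗ₜ[ℂ] K q) := by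
        rw [sub_eq_iff_eq_add'.1 (H_E q), TensorProduct.add_tmul, ← TensorProduct.smul_tmul']
      have h2 : (1 : UqH q) ⊗ₜ[ℂ] (H q * E q)
          = 1 ⊗ₜ[ℂ] (E q * H q) + (2 : ℂ) • ((1 : UqH q) ⊗ₜ[ℂ] E q) := by
        rw [sub_eq_iff_eq_add'.1 (H_E q), TensorProduct.tmul_add, TensorProduct.tmul_smul]
      simp only [mul_add, add_mul, Algebra.TensorProduct.tmul_mul_tmul, mul_one, one_mul, h1, h2,
        H_K, smul_add]
      abel)
    (by
      have h1 : (H q * F q) ⊗ₜ[ℂ] (1 : UqH q)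
          = (F q * H q) ⊗ₜ[ℂ] 1 + (-2 : ℂ) • (F q ⊗ₜ[ℂ] (1 : UqH q)) := by
        rw [sub_eq_iff_eq_add'.1 (H_F q), TensorProduct.add_tmul, ← TensorProduct.smul_tmul']
      have h2 : Kinv q ⊗ₜ[ℂ] (H q * F q)
          = Kinv q ⊗ₜ[ℂ] (F q * H q) + (-2 : ℂ) • (Kinv q ⊗ₜ[ℂ] F q) := by
        rw [sub_eq_iff_eq_add'.1 (H_F q), TensorProduct.tmul_add, TensorProduct.tmul_smul]
      simp only [mul_add, add_mul, Algebra.TensorProduct.tmul_mul_tmul, mul_one, one_mul, h1, h2,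
        H_Kinv, smul_add]
      abel)
    (by simp only [mul_add, add_mul, Algebra.TensorProduct.tmul_mul_tmul, mul_one, one_mul, H_K])

/-- The counit. -/
def counitHom : UqH q →ₐ[ℂ] ℂ :=
  lift 0 0 1 1 0 (by simp) (by simp) (by simp) (by simp) (by simp) (by simp) (by simp) (by simp)

/-- The antipode, as an algebra homomorphism to the opposite algebra. -/
def antipodeHom : UqH q →ₐ[ℂ] (UqH q)ᵐᵒᵖ :=
  lift (.op (-(E q * Kinv q))) (.op (-(K q * F q))) (.op (Kinv q)) (.op (K q)) (.op (-H q))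
    (by rw [← MulOpposite.op_mul, K_Kinv, MulOpposite.op_one])
    (by rw [← MulOpposite.op_mul, Kinv_K, MulOpposite.op_one])
    (by
      rw [← MulOpposite.op_mul, ← MulOpposite.op_mul, ← MulOpposite.op_smul]
      congr 1
      rw [neg_mul, mul_neg, smul_neg, ← mul_assoc, E_Kinv, smul_mul_assoc])
    (by
      rw [← MulOpposite.op_mul, ← MulOpposite.op_mul, ← MulOpposite.op_smul]
      congr 1
      rw [neg_mul, mul_neg, smul_neg, ← mul_assoc, Kinv_K, K_F, smul_mul_assoc, mul_assoc, K_Kinv,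
        one_mul, mul_one])
    (by
      rw [← MulOpposite.op_mul, ← MulOpposite.op_mul, ← MulOpposite.op_sub, ← MulOpposite.op_sub,
        ← MulOpposite.op_smul]
      congr 1
      have h1 : -(K q * F q) * -(E q * Kinv q) = F q * E q := by
        rw [neg_mul_neg]
        by_cases hq : q = 0
        · simp [E_zero q hq]
        · rw [K_F, E_Kinv, smul_mul_smul_comm, mul_assoc, ← mul_assoc (K q), K_Kinv, one_mul]
          simp [hq]
      have h2 : -(E q * Kinv q) * -(K q * F q) = E q * F q := by
        rw [neg_mul_neg, mul_assoc, ← mul_assoc (Kinv q), Kinv_K, one_mul]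
      rw [h1, h2, ← neg_sub, E_F, ← smul_neg, neg_sub])
    (by
      rw [← MulOpposite.op_mul, ← MulOpposite.op_mul, ← MulOpposite.op_sub, ← MulOpposite.op_smul]
      congr 1
      rw [neg_mul_neg, neg_mul_neg, mul_assoc, ← H_Kinv, ← mul_assoc, ← mul_assoc, ← sub_mul,
        ← neg_sub, H_E, smul_neg, neg_mul, smul_mul_assoc])
    (by
      rw [← MulOpposite.op_mul, ← MulOpposite.op_mul, ← MulOpposite.op_sub, ← MulOpposite.op_smul]
      congr 1
      rw [neg_mul_neg, neg_mul_neg, ← mul_assoc, H_K, mul_assoc, mul_assoc, ← mul_sub,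
        ← neg_sub, H_F, smul_neg, mul_neg, mul_smul_comm])
    (by
      rw [← MulOpposite.op_mul, ← MulOpposite.op_mul]
      congr 1
      rw [neg_mul, mul_neg, H_Kinv])

instance : Bialgebra ℂ (UqH q) :=
  Bialgebra.ofAlgHom (comulHom q) (counitHom q)
    (by
      apply algHom_ext <;>
        simp [comulHom, TensorProduct.tmul_add, TensorProduct.add_tmul, add_assoc,
          Algebra.TensorProduct.one_def])
    (by apply algHom_ext <;> simp [comulHom, counitHom])
    (by apply algHom_ext <;> simp [comulHom, counitHom])

theorem comul_eq (a : UqH q) : Coalgebra.comul (R := ℂ) a = comulHom q a := rfl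
theorem counit_eq (a : UqH q) : Coalgebra.counit (R := ℂ) a = counitHom q a := rfl

instance : HopfAlgebra ℂ (UqH q) where
  antipode := (MulOpposite.opLinearEquiv ℂ).symm.toLinearMap ∘ₗ (antipodeHom q).toLinearMap
  mul_antipode_rTensor_comul := LinearMap.ext <| antipode_left (antipodeHom q) _ (adjoin_eq_top q) <| by
    rintro a (rfl | rfl | rfl | rfl | rfl) <;>
      simp [comul_eq, counit_eq, comulHom, counitHom, antipodeHom, K_Kinv, Kinv_K, mul_assoc]
  mul_antipode_lTensor_comul := LinearMap.ext <| antipode_right (antipodeHom q) _ (adjoin_eq_top q) <| by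
    rintro a (rfl | rfl | rfl | rfl | rfl) <;>
      simp [comul_eq, counit_eq, comulHom, counitHom, antipodeHom, K_Kinv, Kinv_K, ← mul_assoc]

end UqH

/-- The inclusion of `U_q(sl₂)` in `U_q(sl₂)` with `H` adjoined, a morphism of bialgebras. -/
def incl (q : ℂ) : Uq q →ₐc[ℂ] UqH q :=
  BialgHom.ofAlgHom
    (Uq.lift (UqH.E q) (UqH.F q) (UqH.K q) (UqH.Kinv q) (UqH.K_Kinv q) (UqH.Kinv_K q)
      (UqH.K_E q) (UqH.K_F q) (UqH.E_F q))
    (by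
      apply Uq.algHom_ext <;>
        simp [Uq.counit_eq, UqH.counit_eq, Uq.counitHom, UqH.counitHom])
    (by
      apply Uq.algHom_ext <;>
        simp [Uq.comul_eq, UqH.comul_eq, Uq.comulHom, UqH.comulHom])

/-! ### The completed tensor square -/

/-- A finite-dimensional representation on `ℂ ^ dim` of `U_q(sl₂)` with `H` adjoined in which
`q ^ H = K`, where `h` is the chosen logarithm of `q`, so that `q ^ H` is `exp (h H)`. -/
structure FinRep (q h : ℂ) where
  /-- The dimension. -/
  dim : ℕ
  /-- The representation. -/
  ρ : UqH q →ₐ[ℂ] Matrix (Fin dim) (Fin dim) ℂ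
  exp_H : NormedSpace.exp (h • ρ (UqH.H q)) = ρ (UqH.K q)

/-- The completed tensor square of `U_q(sl₂)` in which the series of the theory converge: the
product of the algebras `End (V ⊗ W)` over all finite-dimensional representations `V`, `W` with
`q ^ H = K`, with the product topology. (`End (V ⊗ W)` is written as a matrix algebra and has its
usual topology.) -/
abbrev Completion (q h : ℂ) : Type :=
  ∀ V W : FinRep q h, Matrix (Fin V.dim × Fin W.dim) (Fin V.dim × Fin W.dim) ℂ

/-- The canonical map to the completion: `x ⊗ y` acts on `V ⊗ W` as `x` on `V` and `y` on `W`. -/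
def toCompletionH (q h : ℂ) : UqH q ⊗[ℂ] UqH q →ₗ[ℂ] Completion q h :=
  LinearMap.pi fun V => LinearMap.pi fun W =>
    (Matrix.kroneckerAlgEquiv (Fin V.dim) (Fin W.dim) ℂ).toLinearMap ∘ₗ
      TensorProduct.map V.ρ.toLinearMap W.ρ.toLinearMap

/-- The canonical map from `U_q(sl₂) ⊗ U_q(sl₂)` to the completion. -/
def toCompletion (q h : ℂ) : Uq q ⊗[ℂ] Uq q →ₗ[ℂ] Completion q h :=
  toCompletionH q h ∘ₗ
    TensorProduct.map (incl q : Uq q →ₗ[ℂ] UqH q) (incl q : Uq q →ₗ[ℂ] UqH q)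

/-! ### The `R`-matrix and the braided coproduct -/

/-- The `q`-number `[n]_q = (q ^ n - q ^ (-n)) / (q - q ^ (-1))`. -/
def qNumber (q : ℂ) (n : ℕ) : ℂ := (q ^ n - q⁻¹ ^ n) / (q - q⁻¹)

/-- The `q`-factorial `[n]_q! = [n]_q ⋯ [1]_q`. -/
def qFactorial (q : ℂ) (n : ℕ) : ℂ := ∏ i ∈ Finset.range n, qNumber q (i + 1)

/-- The summand of index `(n, l)` of the universal `R`-matrix
`R = q ^ (H ⊗ H / 2) ∑ₙ q ^ (n (n + 1) / 2) (1 - q⁻²) ^ n / [n]_q! (Eⁿ ⊗ Fⁿ)`, with the exponential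
expanded as a power series of index `l`; here `h` is the chosen logarithm of `q`. -/
def RTerm (q h : ℂ) (p : ℕ × ℕ) : UqH q ⊗[ℂ] UqH q :=
  ((h / 2) ^ p.2 / (p.2.factorial : ℂ) *
      (q ^ (p.1 * (p.1 + 1) / 2) * (1 - q ^ (-2 : ℤ)) ^ p.1 / qFactorial q p.1)) •
    ((UqH.H q ^ p.2 * UqH.E q ^ p.1) ⊗ₜ (UqH.H q ^ p.2 * UqH.F q ^ p.1))

/-- The summand `∑ a₍₁₎ S(R₂) ⊗ (R₁ ▷ a₍₂₎)` of the braided coproduct of `a`, with the summand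
of index `(n, l)` of the `R`-matrix as `R₁ ⊗ R₂`. -/
def braidedTerm (q h : ℂ) (a : Uq q) (p : ℕ × ℕ) : Completion q h :=
  toCompletionH q h (transmuted (RTerm q h p) (incl q a))

/-- The braided (transmuted) coproduct of `a`, meaningful when the series is summable. -/
def braidedComul (q h : ℂ) (a : Uq q) : Completion q h :=
  ∑' p : ℕ × ℕ, braidedTerm q h a p

end BraidedSl2

end

open BraidedSl2

/-!
The transmuted coproduct `∑ a₍₁₎ S(R₂) ⊗ (R₁ ▷ a₍₂₎)` of a generator is computed row by row, the
row of index `n` being the sum over `l` of the summands `Hˡ Eⁿ ⊗ Hˡ Fⁿ` of the `R`-matrix.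

The adjoint action is multiplicative in the acting element, and `H ▷ x = [H, x]`. If `y` has weight
`2 w` for it, then `Eⁿ ▷ y` has weight `2 (w + n)`, so `Hˡ` acts on it by the scalar
`(2 (w + n)) ^ l`, while `S(Hˡ)` contributes `(-H) ^ l` to the first tensor factor. The sum over `l`
is therefore an exponential series, with sum `exp (-(w + n) h H) = K ^ (-(w + n))` in every
representation in which `q ^ H = K` (`hasSum_twist_RTerm`). In a finite-dimensional representation
the powers of `F` are eigenvectors of `[H, ·]` for distinct eigenvalues, so that `F` is nilpotent
(`FinRep.exists_F_pow_eq_zero`). As the row of index `n` contains `S(F) ^ n = (-K F) ^ n`, only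
finitely many rows survive in each component of the completion. Hence the double series is
summable, and its sum is the sum of its rows (`hasSum_braidedComul`).

The rows are found from `E ▷ x = [E, x] K⁻¹`. It vanishes on `1` and `E`, sends `K` to a multiple of
`E`, sends `Eⁿ K⁻ᵐ` to `(1 - q ^ (-2 m)) Eⁿ⁺¹ K⁻ᵐ⁻¹`, and `F` to a multiple of `1 - K⁻²`. So two rows
remain for `E` and `K`, and for `K⁻¹` and `F` the product of the factors `1 - q ^ (-2 j)` cancels the
`q`-factorial in the `R`-matrix (`rCoeff_mul_prod`, `rCoeff_succ_mul_prod`).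
-/

noncomputable section

namespace BraidedSl2

/-! ### The adjoint action -/

section Hopf

variable {A : Type*} [Ring A] [HopfAlgebra ℂ A]

theorem adj_mul (a b : A) : adj (a * b) = adj a ∘ₗ adj b := by
  let L : A ⊗[ℂ] A →ₗ[ℂ] A →ₗ[ℂ] A := TensorProduct.lift
    (LinearMap.mk₂ ℂ
      (fun b₁ b₂ : A =>
        LinearMap.mulLeft ℂ b₁ ∘ₗ LinearMap.mulRight ℂ (HopfAlgebra.antipode ℂ b₂))
      (fun _ _ _ => by ext; simp [add_mul])
      (fun _ _ _ => by ext; simp)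
      (fun _ _ _ => by ext; simp [mul_add])
      (fun _ _ _ => by ext; simp))
  have hL : ∀ u v : A ⊗[ℂ] A, L (u * v) = L u ∘ₗ L v := by
    intro u v
    induction u with
    | zero => simp
    | add u u' hu hu' => rw [add_mul, map_add, hu, hu', map_add, LinearMap.add_comp]
    | tmul a b =>
      induction v with
      | zero => simp
      | add v v' hv hv' => rw [mul_add, map_add, hv, hv', map_add, LinearMap.comp_add]
      | tmul c d =>
        ext x
        simp [L, HopfAlgebra.antipode_mul_antidistrib, mul_assoc]
  change L (Coalgebra.comul (a * b)) = L (Coalgebra.comul a) ∘ₗ L (Coalgebra.comul b)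
  rw [Bialgebra.comul_mul, hL]

theorem adj_one : adj (1 : A) = LinearMap.id := by
  ext x
  simp [adj, Algebra.TensorProduct.one_def]

theorem adj_pow (a : A) (n : ℕ) : adj (a ^ n) = adj a ^ n := by
  induction n with
  | zero => rw [pow_zero, adj_one, pow_zero]; rfl
  | succ n ih => rw [pow_succ, adj_mul, ih, pow_succ]; rfl

theorem twist_tmul (r₁ r₂ x y : A) :
    twist (r₁ ⊗ₜ[ℂ] r₂) (x ⊗ₜ[ℂ] y) = (x * HopfAlgebra.antipode ℂ r₂) ⊗ₜ[ℂ] adj r₁ y := by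
  simp [twist]

theorem antipode_pow (a : A) (n : ℕ) :
    HopfAlgebra.antipode ℂ (a ^ n) = HopfAlgebra.antipode ℂ a ^ n := by
  induction n with
  | zero => simp
  | succ n ih => rw [pow_succ, HopfAlgebra.antipode_mul_antidistrib, ih, ← pow_succ']

end Hopf

namespace UqH

variable (q : ℂ)

theorem antipode_F : HopfAlgebra.antipode ℂ (F q) = -(K q * F q) := by
  change (antipodeHom q (F q)).unop = _
  simp [antipodeHom]

theorem antipode_H : HopfAlgebra.antipode ℂ (H q) = -H q := by
  change (antipodeHom q (H q)).unop = _
  simp [antipodeHom]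

theorem antipode_E : HopfAlgebra.antipode ℂ (E q) = -(E q * Kinv q) := by
  change (antipodeHom q (E q)).unop = _
  simp [antipodeHom]

theorem antipode_K : HopfAlgebra.antipode ℂ (K q) = Kinv q := by
  change (antipodeHom q (K q)).unop = _
  simp [antipodeHom]

theorem adj_H (x : UqH q) : adj (H q) x = H q * x - x * H q := by
  simp [adj, comul_eq, comulHom, antipode_H, sub_eq_add_neg]

theorem adj_E (x : UqH q) : adj (E q) x = (E q * x - x * E q) * Kinv q := by
  simp [adj, comul_eq, comulHom, antipode_E, antipode_K, sub_eq_add_neg, add_mul, mul_assoc]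

end UqH

/-! ### Nilpotency and exponentials in finite-dimensional representations -/

namespace FinRep

variable {q h : ℂ}

/-- The powers of `F` are eigenvectors of the commutator with `H`, with distinct eigenvalues,
so that all but finitely many of them vanish in a finite-dimensional representation. -/
theorem exists_F_pow_eq_zero (V : FinRep q h) : ∃ N, V.ρ (UqH.F q) ^ N = 0 := by
  let D : Module.End ℂ (Matrix (Fin V.dim) (Fin V.dim) ℂ) :=
    LinearMap.mulLeft ℂ (V.ρ (UqH.H q)) - LinearMap.mulRight ℂ (V.ρ (UqH.H q))
  have hF : V.ρ (UqH.H q) * V.ρ (UqH.F q)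
      = V.ρ (UqH.F q) * V.ρ (UqH.H q) + (-2 : ℂ) • V.ρ (UqH.F q) := by
    rw [← map_mul, ← map_mul, ← map_smul, ← map_add, ← UqH.H_F, add_sub_cancel]
  have hD : ∀ n : ℕ, D (V.ρ (UqH.F q) ^ n) = (-2 * n : ℂ) • V.ρ (UqH.F q) ^ n := by
    intro n
    simp only [D, LinearMap.sub_apply, LinearMap.mulLeft_apply, LinearMap.mulRight_apply]
    induction n with
    | zero => simp
    | succ n ih =>
      rw [sub_eq_iff_eq_add] at ih ⊢
      rw [pow_succ, ← mul_assoc, ih, add_mul, mul_assoc _ (V.ρ (UqH.H q)), hF, mul_add,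
        mul_smul_comm, smul_mul_assoc, Nat.cast_add, Nat.cast_one, mul_add, add_smul, mul_one,
        ← mul_assoc]
      abel
  by_contra! hne
  refine (Set.infinite_range_of_injective (f := fun n : ℕ => (-2 * n : ℂ)) fun a b hab => ?_).mono
    (Set.range_subset_iff.2 fun n => ?_) (Module.End.finite_hasEigenvalue D)
  · simpa using hab
  · exact Module.End.hasEigenvalue_of_hasEigenvector
      ⟨Module.End.mem_eigenspace_iff.2 (hD n), hne n⟩

theorem hasSum_exp {d : ℕ} (A : Matrix (Fin d) (Fin d) ℂ) :
    HasSum (fun l : ℕ => ((l.factorial : ℂ))⁻¹ • A ^ l) (NormedSpace.exp A) := by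
  open scoped Matrix.Norms.Operator in
  exact NormedSpace.exp_series_hasSum_exp' (𝕂 := ℂ) A

theorem exp_smul_H_of_nat (V : FinRep q h) (m : ℕ) :
    NormedSpace.exp ((-(m : ℂ) * h) • V.ρ (UqH.H q)) = V.ρ (UqH.Kinv q ^ m) := by
  have h1 : V.ρ (UqH.K q) * V.ρ (UqH.Kinv q) = 1 := by rw [← map_mul, UqH.K_Kinv, map_one]
  have h2 : (-(m : ℂ) * h) • V.ρ (UqH.H q) = m • -(h • V.ρ (UqH.H q)) := by
    rw [← Nat.cast_smul_eq_nsmul ℂ, smul_neg, smul_smul, neg_mul, neg_smul]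
  rw [h2, Matrix.exp_nsmul, Matrix.exp_neg, V.exp_H, Matrix.inv_eq_right_inv h1, map_pow]

end FinRep

/-! ### Summation of the `R`-matrix -/

/-- A double series which is summable in each row, and which in each component has only finitely
many non-zero rows, is summable, and can be summed row by row. -/
theorem exists_hasSum_of_rows {q h : ℂ} {f : ℕ × ℕ → Completion q h} {g : ℕ → Completion q h}
    (hf : ∀ n, HasSum (fun l => f (n, l)) (g n))
    (h0 : ∀ V W, ∃ N, ∀ n, N ≤ n → ∀ l, f (n, l) V W = 0) :
    ∃ s, HasSum f s ∧ HasSum g s := by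
  choose N hN using h0
  have hf' : ∀ V W n, HasSum (fun l => f (n, l) V W) (g n V W) := fun V W n =>
    Pi.hasSum.1 (Pi.hasSum.1 (hf n) V) W
  have hg : ∀ V W, ∀ n, N V W ≤ n → g n V W = 0 := fun V W n hn =>
    (hf' V W n).unique (by simpa only [hN V W n hn] using hasSum_zero)
  refine ⟨fun V W => ∑ n ∈ Finset.range (N V W), g n V W,
    Pi.hasSum.2 fun V => Pi.hasSum.2 fun W => ?_, Pi.hasSum.2 fun V => Pi.hasSum.2 fun W =>
      hasSum_sum_of_ne_finset_zero fun n hn => hg V W n (by simpa using hn)⟩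
  have hrow : ∀ n, HasSum (fun p : ℕ × ℕ => if p.1 = n then f p V W else 0) (g n V W) := by
    intro n
    refine ((Prod.mk_right_injective n).hasSum_iff ?_).1 ?_
    · rintro ⟨a, b⟩ hab
      refine if_neg fun h : a = n => hab ⟨b, by rw [h]⟩
    · simpa [Function.comp_def] using hf' V W n
  refine (hasSum_sum fun n (_ : n ∈ Finset.range (N V W)) => hrow n).congr_fun fun p => ?_
  rw [Finset.sum_ite_eq]
  split_ifs with hp
  · rfl
  · exact hN V W p.1 (by simpa using hp) p.2

/-! ### Commutation relations and the adjoint action on generators -/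

namespace UqH

variable (q : ℂ)

theorem K_pow_mul_F (m : ℕ) : K q ^ m * F q = q⁻¹ ^ (2 * m) • (F q * K q ^ m) := by
  have h : K q * F q = q⁻¹ ^ 2 • (F q * K q) := by
    rw [K_F, zpow_neg, inv_pow]; rfl
  induction m with
  | zero => simp
  | succ m ih =>
    rw [pow_succ', mul_assoc, ih, mul_smul_comm, ← mul_assoc, h, smul_mul_assoc, smul_smul,
      mul_assoc, ← pow_add]
    rfl

theorem neg_K_mul_F_pow (n : ℕ) :
    (-(K q * F q)) ^ n = ((-1) ^ n * q⁻¹ ^ (n * (n + 1))) • (F q ^ n * K q ^ n) := by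
  induction n with
  | zero => simp
  | succ n ih =>
    have h : K q ^ n * (K q * F q) = q⁻¹ ^ (2 * (n + 1)) • (F q * K q ^ (n + 1)) := by
      rw [← mul_assoc, ← pow_succ, K_pow_mul_F]
    rw [pow_succ, ih, mul_neg, smul_mul_assoc, mul_assoc, h, mul_smul_comm, smul_smul, ← neg_smul,
      ← mul_assoc, ← pow_succ]
    congr 1
    ring

theorem K_pow_mul_Kinv_pow (n : ℕ) : K q ^ n * Kinv q ^ n = 1 := by
  have h : Commute (K q) (Kinv q) := by rw [commute_iff_eq, K_Kinv, Kinv_K]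
  rw [← h.mul_pow, K_Kinv, one_pow]

theorem neg_K_mul_F_pow_mul_Kinv_pow (n : ℕ) :
    (-(K q * F q)) ^ n * Kinv q ^ n = ((-1) ^ n * q⁻¹ ^ (n * (n + 1))) • F q ^ n := by
  rw [neg_K_mul_F_pow, smul_mul_assoc, mul_assoc, K_pow_mul_Kinv_pow, mul_one]

end UqH

/-! ### Summation of the `R`-matrix along the Cartan part -/

/-- The coefficient of `q ^ (H ⊗ H / 2) (Eⁿ ⊗ Fⁿ)` in the universal `R`-matrix. -/
def rCoeff (q : ℂ) (n : ℕ) : ℂ :=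
  q ^ (n * (n + 1) / 2) * (1 - q ^ (-2 : ℤ)) ^ n / qFactorial q n

variable {q h : ℂ}

theorem twist_RTerm (n l : ℕ) (x y : UqH q) :
    twist (RTerm q h (n, l)) (x ⊗ₜ[ℂ] y)
      = ((h / 2) ^ l / (l.factorial : ℂ) * rCoeff q n) •
        ((x * ((-(UqH.K q * UqH.F q)) ^ n * (-UqH.H q) ^ l)) ⊗ₜ[ℂ]
          (adj (UqH.H q) ^ l) ((adj (UqH.E q) ^ n) y)) := by
  rw [RTerm, map_smul, LinearMap.smul_apply, twist_tmul, adj_mul, adj_pow, adj_pow,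
    HopfAlgebra.antipode_mul_antidistrib, antipode_pow, antipode_pow, UqH.antipode_F,
    UqH.antipode_H, LinearMap.comp_apply]
  rfl

/-- The summands of the transmuted coproduct involve a power of `F` in the first tensor factor,
which vanishes in a given representation once the exponent is large. -/
theorem exists_twist_RTerm_eq_zero (V W : FinRep q h) :
    ∃ N, ∀ n, N ≤ n → ∀ l u, toCompletionH q h (twist (RTerm q h (n, l)) u) V W = 0 := by
  obtain ⟨N, hN⟩ := V.exists_F_pow_eq_zero
  refine ⟨N, fun n hn l u => ?_⟩
  have hKF : V.ρ ((-(UqH.K q * UqH.F q)) ^ n) = 0 := by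
    rw [UqH.neg_K_mul_F_pow, map_smul, map_mul, map_pow _ (UqH.F q),
      pow_eq_zero_of_le hn hN, zero_mul, smul_zero]
  induction u with
  | zero => simp
  | add u v hu hv => rw [map_add, map_add, Pi.add_apply, Pi.add_apply, hu, hv, add_zero]
  | tmul x y =>
    rw [twist_RTerm, map_smul]
    simp only [toCompletionH, Pi.smul_apply, LinearMap.pi_apply, LinearMap.comp_apply,
      TensorProduct.map_tmul, AlgHom.toLinearMap_apply, map_mul V.ρ, hKF, zero_mul, mul_zero,
      TensorProduct.zero_tmul, map_zero, smul_zero]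

/-- If `Eⁿ ▷ y` has weight `2 μ` then the powers of `H ⊗ H` in the `R`-matrix sum up to
`exp (-μ h H)` in the first tensor factor. -/
theorem hasSum_twist_RTerm (n : ℕ) (x y T : UqH q) (μ : ℂ)
    (hμ : adj (UqH.H q) ((adj (UqH.E q) ^ n) y) = (2 * μ) • (adj (UqH.E q) ^ n) y)
    (hT : ∀ V : FinRep q h, NormedSpace.exp ((-μ * h) • V.ρ (UqH.H q)) = V.ρ T) :
    HasSum (fun l => toCompletionH q h (twist (RTerm q h (n, l)) (x ⊗ₜ[ℂ] y)))
      (toCompletionH q h (rCoeff q n •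
        ((x * ((-(UqH.K q * UqH.F q)) ^ n * T)) ⊗ₜ[ℂ] (adj (UqH.E q) ^ n) y))) := by
  set Y := (adj (UqH.E q) ^ n) y with hY
  have hl : ∀ l : ℕ, (adj (UqH.H q) ^ l) Y = (2 * μ) ^ l • Y := by
    intro l
    induction l with
    | zero => simp
    | succ l ih => rw [pow_succ', Module.End.mul_apply, ih, map_smul, hμ, smul_smul, pow_succ]
  refine Pi.hasSum.2 fun V => Pi.hasSum.2 fun W => ?_
  let Φ : Matrix (Fin V.dim) (Fin V.dim) ℂ →ₗ[ℂ]
      Matrix (Fin V.dim × Fin W.dim) (Fin V.dim × Fin W.dim) ℂ :=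
    rCoeff q n • ((Matrix.kroneckerAlgEquiv (Fin V.dim) (Fin W.dim) ℂ).toLinearMap ∘ₗ
      (TensorProduct.mk ℂ _ _).flip (W.ρ Y) ∘ₗ
        LinearMap.mulLeft ℂ (V.ρ (x * (-(UqH.K q * UqH.F q)) ^ n)))
  have hΦ : Continuous Φ := LinearMap.continuous_of_finiteDimensional Φ
  have key := (FinRep.hasSum_exp ((-μ * h) • V.ρ (UqH.H q))).map Φ hΦ
  rw [hT] at key
  convert key using 1
  · funext l
    rw [twist_RTerm, ← hY, hl, Function.comp_apply]
    have hs : (h / 2) ^ l / (l.factorial : ℂ) * rCoeff q n * (-1) ^ l * (2 * μ) ^ l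
        = rCoeff q n * ((l.factorial : ℂ)⁻¹ * (-μ * h) ^ l) := by
      rw [div_pow, mul_pow, mul_pow, neg_pow μ]
      field_simp
    have hH : (-UqH.H q) ^ l = (-1 : ℂ) ^ l • UqH.H q ^ l := by
      rw [← smul_pow, neg_one_smul]
    rw [hH]
    simp only [Φ, toCompletionH, smul_pow, smul_smul, map_smul, mul_smul_comm,
      TensorProduct.tmul_smul, ← TensorProduct.smul_tmul', LinearMap.smul_apply,
      LinearMap.pi_apply, LinearMap.comp_apply, TensorProduct.map_tmul,
      LinearMap.flip_apply, TensorProduct.mk_apply, LinearMap.mulLeft_apply,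
      AlgHom.toLinearMap_apply, map_mul, map_pow, mul_assoc]
    congr 1
    linear_combination hs
  · simp [Φ, toCompletionH]

/-- Summation of the transmuted coproduct row by row. -/
theorem hasSum_braidedComul {a : Uq q} {g : ℕ → UqH q ⊗[ℂ] UqH q}
    (hg : ∀ n, HasSum (fun l => braidedTerm q h a (n, l)) (toCompletionH q h (g n))) :
    Summable (braidedTerm q h a) ∧
      HasSum (fun n => toCompletionH q h (g n)) (braidedComul q h a) := by
  obtain ⟨s, hs, hs'⟩ := exists_hasSum_of_rows hg fun V W =>
    (exists_twist_RTerm_eq_zero V W).imp fun N hN n hn l => hN n hn l _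
  refine ⟨hs.summable, ?_⟩
  rwa [braidedComul, hs.tsum_eq]

namespace UqH

variable {q : ℂ}

theorem Kinv_pow_mul_E (hq : q ≠ 0) (m : ℕ) :
    Kinv q ^ m * E q = q⁻¹ ^ (2 * m) • (E q * Kinv q ^ m) := by
  have h : Kinv q * E q = q⁻¹ ^ 2 • (E q * Kinv q) := by
    rw [E_Kinv, smul_smul, ← mul_pow, inv_mul_cancel₀ hq, one_pow, one_smul]
  induction m with
  | zero => simp
  | succ m ih =>
    rw [pow_succ', mul_assoc, ih, mul_smul_comm, ← mul_assoc, h, smul_mul_assoc, smul_smul,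
      mul_assoc, ← pow_add]
    rfl

theorem adj_E_E_pow_mul_Kinv_pow (hq : q ≠ 0) (n m : ℕ) :
    adj (E q) (E q ^ n * Kinv q ^ m)
      = (1 - q⁻¹ ^ (2 * m)) • (E q ^ (n + 1) * Kinv q ^ (m + 1)) := by
  rw [adj_E, mul_assoc (E q ^ n), Kinv_pow_mul_E hq, mul_smul_comm, ← mul_assoc, ← mul_assoc,
    ← pow_succ', ← pow_succ, sub_mul, smul_mul_assoc, mul_assoc, ← pow_succ, sub_smul, one_smul]

theorem adj_E_pow_Kinv_pow (hq : q ≠ 0) (n m : ℕ) :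
    (adj (E q) ^ n) (Kinv q ^ m)
      = (∏ j ∈ Finset.range n, (1 - q⁻¹ ^ (2 * (j + m)))) • (E q ^ n * Kinv q ^ (n + m)) := by
  induction n with
  | zero => simp
  | succ n ih =>
    rw [pow_succ', Module.End.mul_apply, ih, map_smul, adj_E_E_pow_mul_Kinv_pow hq, smul_smul,
      Finset.prod_range_succ, add_right_comm]

theorem adj_E_one : adj (E q) 1 = 0 := by simp [adj_E]

theorem adj_E_E : adj (E q) (E q) = 0 := by simp [adj_E]

theorem adj_E_K : adj (E q) (K q) = (1 - q ^ 2) • E q := by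
  rw [adj_E, K_E, sub_mul, smul_mul_assoc, mul_assoc, K_Kinv, mul_one, sub_smul, one_smul]

theorem adj_E_F : adj (E q) (F q) = (q - q⁻¹)⁻¹ • (1 - Kinv q ^ 2) := by
  rw [adj_E, E_F, smul_mul_assoc, sub_mul, K_Kinv, sq]

theorem adj_E_pow_eq_zero {x : UqH q} {m n : ℕ} (hx : (adj (E q) ^ m) x = 0) (hmn : m ≤ n) :
    (adj (E q) ^ n) x = 0 := by
  rw [← Nat.sub_add_cancel hmn, pow_add, Module.End.mul_apply, hx, map_zero]

/-- The adjoint action of `E` raises weights by `2`. -/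
theorem adj_H_adj_E_pow {y : UqH q} {w : ℂ} (hy : adj (H q) y = (2 * w) • y) (n : ℕ) :
    adj (H q) ((adj (E q) ^ n) y) = (2 * (w + n)) • (adj (E q) ^ n) y := by
  have hHE : ∀ z, adj (H q) (adj (E q) z) = adj (E q) (adj (H q) z) + (2 : ℂ) • adj (E q) z := by
    intro z
    have h := congrArg (fun a => adj a z) (sub_eq_iff_eq_add'.1 (H_E q))
    simpa [adj_mul] using h
  induction n with
  | zero => simpa using hy
  | succ n ih =>
    rw [pow_succ', Module.End.mul_apply, hHE, ih, map_smul, ← add_smul]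
    congr 1
    push_cast
    ring

theorem Kinv_mul_F_pow_mul_K (hq : q ≠ 0) (n : ℕ) :
    Kinv q * F q ^ n * K q = q ^ (2 * n) • F q ^ n := by
  have h : Kinv q * F q = q ^ 2 • (F q * Kinv q) := by
    rw [F_Kinv, smul_smul, zpow_neg]
    norm_cast
    rw [mul_inv_cancel₀ (pow_ne_zero _ hq), one_smul]
  have hn : Kinv q * F q ^ n = q ^ (2 * n) • (F q ^ n * Kinv q) := by
    induction n with
    | zero => simp
    | succ n ih =>
      rw [pow_succ, ← mul_assoc, ih, smul_mul_assoc, mul_assoc, h, mul_smul_comm, smul_smul,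
        mul_assoc, ← pow_add]
      rfl
  rw [hn, smul_mul_assoc, mul_assoc, Kinv_K, mul_one]

end UqH

/-! ### Coefficients -/

section Coefficients

variable {q : ℂ}

@[simp]
theorem rCoeff_zero : rCoeff q 0 = 1 := by simp [rCoeff, qFactorial]

theorem rCoeff_succ (n : ℕ) :
    rCoeff q (n + 1)
      = rCoeff q n * (q ^ (n + 1) * (1 - q ^ (-2 : ℤ)) / qNumber q (n + 1)) := by
  have h : (n + 1) * (n + 1 + 1) / 2 = n * (n + 1) / 2 + (n + 1) := by
    rw [show (n + 1) * (n + 1 + 1) = n * (n + 1) + (n + 1) * 2 by ring,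
      Nat.add_mul_div_right _ _ two_pos]
  rw [rCoeff, rCoeff, h, qFactorial, Finset.prod_range_succ, ← qFactorial, pow_add, pow_succ _ n]
  simp only [div_eq_mul_inv, mul_inv]
  ring

theorem sub_inv_ne_zero (hq : q ≠ 0) (hroot : ∀ n : ℕ, 0 < n → q ^ n ≠ 1) : q - q⁻¹ ≠ 0 := by
  intro h
  apply hroot 2 two_pos
  rw [sq]
  nth_rw 2 [sub_eq_zero.1 h]
  exact mul_inv_cancel₀ hq

theorem pow_sub_inv_pow_ne_zero (hq : q ≠ 0) (hroot : ∀ n : ℕ, 0 < n → q ^ n ≠ 1)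
    (n : ℕ) : q ^ (n + 1) - q⁻¹ ^ (n + 1) ≠ 0 := by
  intro h
  apply hroot ((n + 1) + (n + 1)) (by omega)
  rw [pow_add]
  nth_rw 2 [sub_eq_zero.1 h]
  rw [← mul_pow, mul_inv_cancel₀ hq, one_pow]

theorem rCoeff_one (hq : q ≠ 0) (hroot : ∀ n : ℕ, 0 < n → q ^ n ≠ 1) : rCoeff q 1 = q - q⁻¹ := by
  have := sub_inv_ne_zero hq hroot
  rw [rCoeff_succ, rCoeff_zero, qNumber, zero_add, pow_one, pow_one, div_self this, zpow_neg]
  norm_cast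
  field_simp

/-- The product comes from the action of `Eⁿ` on `K⁻¹`; it cancels the `q`-factorial. -/
theorem rCoeff_mul_prod (hq : q ≠ 0) (hroot : ∀ n : ℕ, 0 < n → q ^ n ≠ 1)
    (n : ℕ) :
    rCoeff q n * ∏ j ∈ Finset.range n, (1 - q⁻¹ ^ (2 * (j + 1)))
      = (q - q⁻¹) ^ (2 * n) * q⁻¹ ^ n := by
  induction n with
  | zero => simp
  | succ n ih =>
    have h1 := sub_inv_ne_zero hq hroot
    have h2 := pow_sub_inv_pow_ne_zero hq hroot n
    have h3 : q ^ (n + 1) * (1 - q⁻¹ ^ (2 * (n + 1))) = q ^ (n + 1) - q⁻¹ ^ (n + 1) := by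
      rw [mul_sub, mul_one, two_mul, pow_add q⁻¹, ← mul_assoc, ← mul_pow, mul_inv_cancel₀ hq,
        one_pow, one_mul]
    have h4 : (1 - q ^ (-2 : ℤ)) = q⁻¹ * (q - q⁻¹) := by
      rw [mul_sub, inv_mul_cancel₀ hq, ← sq, zpow_neg, inv_pow]; rfl
    rw [rCoeff_succ, Finset.prod_range_succ, qNumber, h4]
    calc _ = (rCoeff q n * ∏ j ∈ Finset.range n, (1 - q⁻¹ ^ (2 * (j + 1)))) *
          ((q ^ (n + 1) * (1 - q⁻¹ ^ (2 * (n + 1)))) /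
            ((q ^ (n + 1) - q⁻¹ ^ (n + 1)) / (q - q⁻¹)) * (q⁻¹ * (q - q⁻¹))) := by ring
      _ = _ := by
        rw [ih, h3, div_div_cancel₀ h2]
        ring

/-- The product comes from the action of `Eⁿ` on `K⁻²`, which is a multiple of the action
of `Eⁿ⁺¹` on `F`. -/
theorem rCoeff_succ_mul_prod (hq : q ≠ 0) (hroot : ∀ n : ℕ, 0 < n → q ^ n ≠ 1)
    (n : ℕ) :
    rCoeff q (n + 1) * ((q - q⁻¹)⁻¹ * ∏ j ∈ Finset.range n, (1 - q⁻¹ ^ (2 * (j + 2))))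
      = (q - q⁻¹) ^ (2 * n) * q⁻¹ ^ n := by
  have h1 := sub_inv_ne_zero hq hroot
  have h4 : (1 - q⁻¹ ^ (2 * (0 + 1))) = q⁻¹ * (q - q⁻¹) := by
    rw [mul_sub, inv_mul_cancel₀ hq, ← sq]
  have h := rCoeff_mul_prod hq hroot (n + 1)
  rw [Finset.prod_range_succ', h4] at h
  have h5 : q⁻¹ * (q - q⁻¹) ^ 2 ≠ 0 := mul_ne_zero (inv_ne_zero hq) (pow_ne_zero _ h1)
  refine mul_right_cancel₀ h5 ?_
  calc _ = (rCoeff q (n + 1) * ((∏ j ∈ Finset.range n, (1 - q⁻¹ ^ (2 * (j + 1 + 1)))) *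
        (q⁻¹ * (q - q⁻¹)))) * ((q - q⁻¹)⁻¹ * (q - q⁻¹)) := by ring
    _ = _ := by
      rw [h, inv_mul_cancel₀ h1]
      ring

end Coefficients

/-! ### The braided coproducts of the generators, row by row -/

section Rows

variable {q h : ℂ}

/-- A row of the double series for `x ⊗ y`, with `y` of weight `2 w` such that `w + n` is a natural
number `m`: the Cartan part of the `R`-matrix contributes `K ^ (-m)`. -/
theorem hasSum_twist_of_weight (n m : ℕ) {w : ℂ} (x : UqH q) {y : UqH q}
    (hy : adj (UqH.H q) y = (2 * w) • y) (hm : w + n = m) :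
    HasSum (fun l => toCompletionH q h (twist (RTerm q h (n, l)) (x ⊗ₜ[ℂ] y)))
      (toCompletionH q h (rCoeff q n •
        ((x * ((-(UqH.K q * UqH.F q)) ^ n * UqH.Kinv q ^ m)) ⊗ₜ[ℂ] (adj (UqH.E q) ^ n) y))) :=
  hasSum_twist_RTerm n x y _ m (hm ▸ UqH.adj_H_adj_E_pow hy n) fun V => V.exp_smul_H_of_nat m

theorem adj_H_one : adj (UqH.H q) 1 = (2 * 0 : ℂ) • (1 : UqH q) := by
  simp [UqH.adj_H]

theorem adj_H_K : adj (UqH.H q) (UqH.K q) = (2 * 0 : ℂ) • UqH.K q := by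
  simp [UqH.adj_H, UqH.H_K]

theorem adj_H_Kinv : adj (UqH.H q) (UqH.Kinv q) = (2 * 0 : ℂ) • UqH.Kinv q := by
  simp [UqH.adj_H, UqH.H_Kinv]

theorem adj_H_E : adj (UqH.H q) (UqH.E q) = (2 * 1 : ℂ) • UqH.E q := by
  rw [UqH.adj_H, UqH.H_E, mul_one]

theorem adj_H_F : adj (UqH.H q) (UqH.F q) = (2 * (-1) : ℂ) • UqH.F q := by
  rw [UqH.adj_H, UqH.H_F, mul_neg_one]

@[simp] theorem incl_E : incl q (Uq.E q) = UqH.E q := Uq.lift_E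
@[simp] theorem incl_F : incl q (Uq.F q) = UqH.F q := Uq.lift_F
@[simp] theorem incl_K : incl q (Uq.K q) = UqH.K q := Uq.lift_K
@[simp] theorem incl_Kinv : incl q (Uq.Kinv q) = UqH.Kinv q := Uq.lift_Kinv

theorem toCompletion_tmul (x y : Uq q) :
    toCompletion q h (x ⊗ₜ y) = toCompletionH q h (incl q x ⊗ₜ incl q y) := rfl

theorem hasSum_braidedTerm_K (n : ℕ) :
    HasSum (fun l => braidedTerm q h (Uq.K q) (n, l))
      (toCompletionH q h (rCoeff q n • ((UqH.K q * ((-(UqH.K q * UqH.F q)) ^ n *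
        UqH.Kinv q ^ n)) ⊗ₜ[ℂ] (adj (UqH.E q) ^ n) (UqH.K q)))) := by
  have hc : Coalgebra.comul (R := ℂ) (UqH.K q) = UqH.K q ⊗ₜ[ℂ] UqH.K q := by
    simp [UqH.comul_eq, UqH.comulHom]
  simpa only [braidedTerm, transmuted, incl_K, hc] using
    hasSum_twist_of_weight n n (UqH.K q) adj_H_K (zero_add _)

theorem hasSum_braidedTerm_Kinv (n : ℕ) :
    HasSum (fun l => braidedTerm q h (Uq.Kinv q) (n, l))
      (toCompletionH q h (rCoeff q n • ((UqH.Kinv q * ((-(UqH.K q * UqH.F q)) ^ n *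
        UqH.Kinv q ^ n)) ⊗ₜ[ℂ] (adj (UqH.E q) ^ n) (UqH.Kinv q)))) := by
  have hc : Coalgebra.comul (R := ℂ) (UqH.Kinv q) = UqH.Kinv q ⊗ₜ[ℂ] UqH.Kinv q := by
    simp [UqH.comul_eq, UqH.comulHom]
  simpa only [braidedTerm, transmuted, incl_Kinv, hc] using
    hasSum_twist_of_weight n n (UqH.Kinv q) adj_H_Kinv (zero_add _)

theorem hasSum_braidedTerm_E (n : ℕ) :
    HasSum (fun l => braidedTerm q h (Uq.E q) (n, l))
      (toCompletionH q h (rCoeff q n • ((UqH.E q * ((-(UqH.K q * UqH.F q)) ^ n *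
          UqH.Kinv q ^ n)) ⊗ₜ[ℂ] (adj (UqH.E q) ^ n) (UqH.K q)) +
        rCoeff q n • ((1 * ((-(UqH.K q * UqH.F q)) ^ n *
          UqH.Kinv q ^ (n + 1))) ⊗ₜ[ℂ] (adj (UqH.E q) ^ n) (UqH.E q)))) := by
  have hc : Coalgebra.comul (R := ℂ) (UqH.E q)
      = UqH.E q ⊗ₜ[ℂ] UqH.K q + 1 ⊗ₜ[ℂ] UqH.E q := by
    simp [UqH.comul_eq, UqH.comulHom]
  simpa only [braidedTerm, transmuted, incl_E, hc, map_add] using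
    (hasSum_twist_of_weight n n (UqH.E q) adj_H_K (zero_add _)).add
      (hasSum_twist_of_weight n (n + 1) 1 adj_H_E (by push_cast; ring))

theorem comul_F : Coalgebra.comul (R := ℂ) (UqH.F q)
    = UqH.F q ⊗ₜ[ℂ] 1 + UqH.Kinv q ⊗ₜ[ℂ] UqH.F q := by
  simp [UqH.comul_eq, UqH.comulHom]

theorem hasSum_braidedTerm_F_zero :
    HasSum (fun l => braidedTerm q h (Uq.F q) (0, l))
      (toCompletionH q h (UqH.F q ⊗ₜ[ℂ] 1 + 1 ⊗ₜ[ℂ] UqH.F q)) := by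
  have h1 := hasSum_twist_of_weight (h := h) 0 0 (UqH.F q) adj_H_one (zero_add _)
  -- `F` has weight `-2`, so that the Cartan part contributes `q ^ H = K`.
  have h2 := hasSum_twist_RTerm (h := h) 0 (UqH.Kinv q) (UqH.F q) (UqH.K q) (-1)
    (by simpa using adj_H_F) (fun V => by rw [neg_neg, one_mul, V.exp_H])
  simpa [braidedTerm, transmuted, comul_F, UqH.Kinv_K] using h1.add h2

theorem hasSum_braidedTerm_F_succ (n : ℕ) :
    HasSum (fun l => braidedTerm q h (Uq.F q) (n + 1, l))
      (toCompletionH q h (rCoeff q (n + 1) • ((UqH.Kinv q * ((-(UqH.K q * UqH.F q)) ^ (n + 1) *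
        UqH.Kinv q ^ n)) ⊗ₜ[ℂ] (adj (UqH.E q) ^ (n + 1)) (UqH.F q)))) := by
  have h1 := hasSum_twist_of_weight (h := h) (n + 1) (n + 1) (UqH.F q) adj_H_one (zero_add _)
  have h2 := hasSum_twist_of_weight (h := h) (n + 1) n (UqH.Kinv q) adj_H_F
    (by push_cast; ring)
  have h0 : (adj (UqH.E q) ^ (n + 1)) 1 = 0 :=
    UqH.adj_E_pow_eq_zero (m := 1) (by simpa using UqH.adj_E_one) (by omega)
  rw [h0, TensorProduct.tmul_zero, smul_zero, map_zero] at h1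
  simpa only [braidedTerm, transmuted, incl_F, comul_F, map_add, zero_add] using h1.add h2

end Rows

/-! ### Closed forms -/

section ClosedForms

variable {q : ℂ} (h : ℂ)

theorem braidedComul_E (hq : q ≠ 0) (hroot : ∀ n : ℕ, 0 < n → q ^ n ≠ 1) :
    braidedComul q h (Uq.E q) = toCompletion q h
        (Uq.E q ⊗ₜ Uq.K q + Uq.Kinv q ⊗ₜ Uq.E q
          + (q⁻¹ * (q - q⁻¹) ^ 2) • ((Uq.E q * Uq.F q) ⊗ₜ Uq.E q)) := by
  refine ((hasSum_braidedComul (h := h) hasSum_braidedTerm_E).2.unique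
    (hasSum_sum_of_ne_finset_zero (s := Finset.range 2) fun n hn => ?_)).trans ?_
  · have hn' : 2 ≤ n := by
      rw [Finset.mem_range] at hn
      omega
    rw [UqH.adj_E_pow_eq_zero (m := 2) (by simp [sq, UqH.adj_E_K, UqH.adj_E_E]) hn',
      UqH.adj_E_pow_eq_zero (m := 1) (by simp [UqH.adj_E_E]) (by omega)]
    simp
  · rw [Finset.sum_range_succ, Finset.sum_range_one, ← map_add]
    simp only [map_add, map_smul, toCompletion_tmul, map_mul, incl_E, incl_F, incl_K, incl_Kinv]
    simp only [← map_add, ← map_smul]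
    congr 1
    simp only [UqH.neg_K_mul_F_pow_mul_Kinv_pow, rCoeff_one hq hroot]
    simp only [rCoeff_zero, pow_zero, pow_one, zero_add, UqH.adj_E_E, UqH.adj_E_K,
      Module.End.one_apply, mul_smul_comm, ← TensorProduct.smul_tmul', TensorProduct.tmul_smul,
      TensorProduct.tmul_zero, smul_zero, add_zero, one_mul, mul_one, one_smul, smul_smul]
    congr 2
    rw [one_add_one_eq_two]
    field_simp
    ring

theorem braidedComul_K (hq : q ≠ 0) (hroot : ∀ n : ℕ, 0 < n → q ^ n ≠ 1) :
    braidedComul q h (Uq.K q) = toCompletion q h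
        (Uq.K q ⊗ₜ Uq.K q + (q⁻¹ * (q - q⁻¹) ^ 2) • ((Uq.K q * Uq.F q) ⊗ₜ Uq.E q)) := by
  refine ((hasSum_braidedComul (h := h) hasSum_braidedTerm_K).2.unique
    (hasSum_sum_of_ne_finset_zero (s := Finset.range 2) fun n hn => ?_)).trans ?_
  · have hn' : 2 ≤ n := by
      rw [Finset.mem_range] at hn
      omega
    rw [UqH.adj_E_pow_eq_zero (m := 2) (by simp [sq, UqH.adj_E_K, UqH.adj_E_E]) hn']
    simp
  · rw [Finset.sum_range_succ, Finset.sum_range_one, ← map_add]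
    simp only [map_add, map_smul, toCompletion_tmul, map_mul, incl_E, incl_F, incl_K]
    simp only [← map_add, ← map_smul]
    congr 1
    simp only [UqH.neg_K_mul_F_pow_mul_Kinv_pow, rCoeff_one hq hroot]
    simp only [rCoeff_zero, zero_mul, pow_zero, pow_one, UqH.adj_E_K,
      Module.End.one_apply, mul_smul_comm, ← TensorProduct.smul_tmul', TensorProduct.tmul_smul,
      mul_one, one_smul, smul_smul]
    congr 2
    rw [show 1 * (1 + 1) = 2 from rfl]
    field_simp
    ring

theorem hasSum_braidedComul_Kinv (hq : q ≠ 0) (hroot : ∀ n : ℕ, 0 < n → q ^ n ≠ 1) :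
    HasSum
      (fun n : ℕ => toCompletion q h
        (((-1) ^ n * q ^ (-(n : ℤ) ^ 2 - 2 * n) * (q - q⁻¹) ^ (2 * n)) •
          ((Uq.Kinv q * Uq.F q ^ n) ⊗ₜ[ℂ] (Uq.E q ^ n * Uq.Kinv q ^ (n + 1)))))
      (braidedComul q h (Uq.Kinv q)) := by
  convert (hasSum_braidedComul (h := h) hasSum_braidedTerm_Kinv).2 using 1
  funext n
  have hY := UqH.adj_E_pow_Kinv_pow hq n 1
  rw [pow_one] at hY
  simp only [map_smul, toCompletion_tmul, map_mul, map_pow, incl_E, incl_F, incl_Kinv]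
  simp only [← map_smul]
  rw [UqH.neg_K_mul_F_pow_mul_Kinv_pow, hY]
  simp only [mul_smul_comm, ← TensorProduct.smul_tmul', TensorProduct.tmul_smul, smul_smul]
  congr 2
  have hz : q ^ (-(n : ℤ) ^ 2 - 2 * n) = q⁻¹ ^ n * q⁻¹ ^ (n * (n + 1)) := by
    rw [← pow_add, inv_pow, ← zpow_natCast, ← zpow_neg]
    congr 1
    push_cast
    ring
  rw [hz]
  linear_combination (-((-1) ^ n * q⁻¹ ^ (n * (n + 1)))) * rCoeff_mul_prod hq hroot n

/-- The row of index `n + 1` in the braided coproduct of `F`. In the first one `E ▷ F` is a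
combination of `1` and `K⁻²`, and the part in `1` cancels against a summand of the row of
index `0`; further powers of `E` annihilate `1`. -/
theorem row_F_succ_eq (hq : q ≠ 0) (hroot : ∀ n : ℕ, 0 < n → q ^ n ≠ 1) (n : ℕ) :
    rCoeff q (n + 1) • ((UqH.Kinv q * ((-(UqH.K q * UqH.F q)) ^ (n + 1) *
        UqH.Kinv q ^ n)) ⊗ₜ[ℂ] (adj (UqH.E q) ^ (n + 1)) (UqH.F q))
      = ((-1) ^ n * q⁻¹ ^ (n * (n + 2)) * (q - q⁻¹) ^ (2 * n)) •
          ((UqH.F q ^ (n + 1)) ⊗ₜ[ℂ] (UqH.E q ^ n * UqH.Kinv q ^ (n + 2)))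
        + (if n = 0 then -(UqH.F q ⊗ₜ[ℂ] (1 : UqH q)) else 0) := by
  have hx : UqH.Kinv q * ((-(UqH.K q * UqH.F q)) ^ (n + 1) * UqH.Kinv q ^ n)
      = (-((-1) ^ n * q⁻¹ ^ (n * (n + 1)))) • UqH.F q ^ (n + 1) := by
    rw [UqH.neg_K_mul_F_pow, smul_mul_assoc, pow_succ' (UqH.K q), mul_assoc, mul_assoc,
      UqH.K_pow_mul_Kinv_pow, mul_one, mul_smul_comm, ← mul_assoc, UqH.Kinv_mul_F_pow_mul_K hq,
      smul_smul]
    congr 1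
    have : q⁻¹ ^ (2 * (n + 1)) * q ^ (2 * (n + 1)) = 1 := by
      rw [← mul_pow, inv_mul_cancel₀ hq, one_pow]
    calc _ = -((-1) ^ n * q⁻¹ ^ (n * (n + 1))) * (q⁻¹ ^ (2 * (n + 1)) * q ^ (2 * (n + 1))) := by
          ring
      _ = _ := by rw [this, mul_one]
  have hY : (adj (UqH.E q) ^ (n + 1)) (UqH.F q)
      = (q - q⁻¹)⁻¹ • ((if n = 0 then 1 else 0) -
        (∏ j ∈ Finset.range n, (1 - q⁻¹ ^ (2 * (j + 2)))) •
          (UqH.E q ^ n * UqH.Kinv q ^ (n + 2))) := by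
    rw [pow_succ, Module.End.mul_apply, UqH.adj_E_F, map_smul, map_sub,
      UqH.adj_E_pow_Kinv_pow hq]
    congr 2
    split_ifs with hn
    · simp [hn]
    · exact UqH.adj_E_pow_eq_zero (m := 1) (by simpa using UqH.adj_E_one) (by omega)
  have hc := rCoeff_succ_mul_prod hq hroot n
  rw [hx, hY]
  simp only [← TensorProduct.smul_tmul', TensorProduct.tmul_smul, TensorProduct.tmul_sub,
    smul_sub, smul_smul]
  rw [sub_eq_add_neg, add_comm, ← neg_smul]
  congr 1
  · congr 1
    linear_combination ((-1) ^ n * q⁻¹ ^ (n * (n + 1))) * hc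
  · split_ifs with hn
    · subst hn
      simp [rCoeff_one hq hroot, sub_inv_ne_zero hq hroot]
    · simp

theorem hasSum_braidedComul_F (hq : q ≠ 0) (hroot : ∀ n : ℕ, 0 < n → q ^ n ≠ 1) :
    Summable (braidedTerm q h (Uq.F q)) ∧
      HasSum
        (fun n : ℕ+ => toCompletion q h
          (((-1) ^ ((n : ℕ) + 1) * q ^ (-((n : ℕ) : ℤ) ^ 2 + 1)
              * (q - q⁻¹) ^ (2 * (n : ℕ) - 2)) •
            ((Uq.F q ^ (n : ℕ)) ⊗ₜ[ℂ] (Uq.E q ^ ((n : ℕ) - 1) * Uq.Kinv q ^ ((n : ℕ) + 1)))))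
        (braidedComul q h (Uq.F q) - toCompletion q h (1 ⊗ₜ Uq.F q)) := by
  let g : ℕ → UqH q ⊗[ℂ] UqH q := fun n => match n with
    | 0 => UqH.F q ⊗ₜ[ℂ] 1 + 1 ⊗ₜ[ℂ] UqH.F q
    | n + 1 => rCoeff q (n + 1) • ((UqH.Kinv q * ((-(UqH.K q * UqH.F q)) ^ (n + 1) *
        UqH.Kinv q ^ n)) ⊗ₜ[ℂ] (adj (UqH.E q) ^ (n + 1)) (UqH.F q))
  have hg : ∀ n, HasSum (fun l => braidedTerm q h (Uq.F q) (n, l)) (toCompletionH q h (g n)) := by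
    rintro (_ | n)
    · exact hasSum_braidedTerm_F_zero
    · exact hasSum_braidedTerm_F_succ n
  obtain ⟨hs, hsum⟩ := hasSum_braidedComul hg
  refine ⟨hs, ?_⟩
  have h1 := (hasSum_nat_add_iff' 1).2 hsum
  simp only [Finset.sum_range_one, g, row_F_succ_eq hq hroot] at h1
  have h2 : HasSum (fun n : ℕ => toCompletionH q h
      (if n = 0 then -(UqH.F q ⊗ₜ[ℂ] (1 : UqH q)) else 0))
      (toCompletionH q h (-(UqH.F q ⊗ₜ[ℂ] (1 : UqH q)))) := by
    convert hasSum_ite_eq (0 : ℕ) (toCompletionH q h (-(UqH.F q ⊗ₜ[ℂ] (1 : UqH q)))) using 2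
    split_ifs <;> simp
  have h3 := h1.sub h2
  rw [← Equiv.pnatEquivNat.symm.hasSum_iff]
  have hval : braidedComul q h (Uq.F q) - toCompletion q h (1 ⊗ₜ Uq.F q)
      = braidedComul q h (Uq.F q) - toCompletionH q h (UqH.F q ⊗ₜ[ℂ] 1 + 1 ⊗ₜ[ℂ] UqH.F q)
        - toCompletionH q h (-(UqH.F q ⊗ₜ[ℂ] (1 : UqH q))) := by
    simp only [toCompletion_tmul, map_one, incl_F, map_add, map_neg]
    abel
  rw [hval]
  refine h3.congr_fun fun n => ?_
  rw [← map_sub, add_sub_cancel_right]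
  simp only [Function.comp_apply, Equiv.pnatEquivNat_symm_apply, Nat.succPNat_coe,
    Nat.succ_eq_add_one, map_smul, toCompletion_tmul, map_mul, map_pow, incl_E, incl_F,
    incl_Kinv, Nat.add_sub_cancel]
  congr 1
  have hz : q ^ (-((n + 1 : ℕ) : ℤ) ^ 2 + 1) = q⁻¹ ^ (n * (n + 2)) := by
    rw [inv_pow, ← zpow_natCast, ← zpow_neg]
    congr 1
    push_cast
    ring
  rw [hz, show 2 * (n + 1) - 2 = 2 * n by omega, pow_succ (-1 : ℂ) (n + 1), pow_succ (-1 : ℂ) n]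
  ring

end ClosedForms

end BraidedSl2

end

theorem theorem3p1 (q h : ℂ) (hq : Complex.exp h = q) (hroot : ∀ n : ℕ, 0 < n → q ^ n ≠ 1) :
    -- the coproduct of `E`
    (Summable (braidedTerm q h (Uq.E q)) ∧
      braidedComul q h (Uq.E q) = toCompletion q h
        (Uq.E q ⊗ₜ Uq.K q + Uq.Kinv q ⊗ₜ Uq.E q
          + (q⁻¹ * (q - q⁻¹) ^ 2) • ((Uq.E q * Uq.F q) ⊗ₜ Uq.E q))) ∧
    -- the coproduct of `K`
    (Summable (braidedTerm q h (Uq.K q)) ∧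
      braidedComul q h (Uq.K q) = toCompletion q h
        (Uq.K q ⊗ₜ Uq.K q + (q⁻¹ * (q - q⁻¹) ^ 2) • ((Uq.K q * Uq.F q) ⊗ₜ Uq.E q))) ∧
    -- the coproduct of `K⁻¹`
    (Summable (braidedTerm q h (Uq.Kinv q)) ∧
      HasSum
        (fun n : ℕ => toCompletion q h
          (((-1) ^ n * q ^ (-(n : ℤ) ^ 2 - 2 * n) * (q - q⁻¹) ^ (2 * n)) •
            ((Uq.Kinv q * Uq.F q ^ n) ⊗ₜ[ℂ] (Uq.E q ^ n * Uq.Kinv q ^ (n + 1)))))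
        (braidedComul q h (Uq.Kinv q))) ∧
    -- the coproduct of `F`; the sum runs over `n ≥ 1`
    (Summable (braidedTerm q h (Uq.F q)) ∧
      ∃ s : Completion q h,
        HasSum
          (fun n : ℕ+ => toCompletion q h
            (((-1) ^ ((n : ℕ) + 1) * q ^ (-((n : ℕ) : ℤ) ^ 2 + 1)
                * (q - q⁻¹) ^ (2 * (n : ℕ) - 2)) •
              ((Uq.F q ^ (n : ℕ)) ⊗ₜ[ℂ] (Uq.E q ^ ((n : ℕ) - 1) * Uq.Kinv q ^ ((n : ℕ) + 1)))))
          s ∧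
        braidedComul q h (Uq.F q) = toCompletion q h (1 ⊗ₜ Uq.F q) + s) := by
  have hq0 : q ≠ 0 := hq ▸ Complex.exp_ne_zero h
  obtain ⟨hF, hF'⟩ := hasSum_braidedComul_F h hq0 hroot
  exact ⟨⟨(hasSum_braidedComul hasSum_braidedTerm_E).1, braidedComul_E h hq0 hroot⟩,
    ⟨(hasSum_braidedComul hasSum_braidedTerm_K).1, braidedComul_K h hq0 hroot⟩,
    ⟨(hasSum_braidedComul hasSum_braidedTerm_Kinv).1, hasSum_braidedComul_Kinv h hq0 hroot⟩,
    hF, _, hF', (add_sub_cancel _ _).symm⟩
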